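/- Let $\mathcal M$ be the category of modules, or of $\mathbb N_0$-graded modules, over a commutative unital ring $R$ (more generally, a Grothendieck abelian category in which products are exact). For an abstract simplicial complex $K$ with vertex set $V$ (all singletons of $V$ being simplices), give the set of its simplices the Alexandrov topology, in which a set is open if it contains with a simplex all its cofaces. Let $U_\sigma=\{\tau\in K:\sigma\subseteq\tau\}$ be the smallest open set containing $\sigma$. Sheaves on $K$ have values in $\mathcal M$; for a sheaf $\mathcal F$ put $\mathcal F(\sigma):=\mathcal F(U_\sigma)$, with restriction maps $\mathcal F(\sigma\to\tau)$ for $\sigma\subseteq\tau$, and let $H^k(K,\mathcal F)$ be the value at $\mathcal F$ of the $k$-th right derived functor of the global section functor $\Gamma(K,-)$. Choose a linear order on $V$, let $K^k$ be the set of simplices with $k+1$ vertices, and let $C^\bullet(K,\mathcal F)$ be the cellular cochain complex $$C^k(K,\mathcal F)=\prod_{\sigma\in K^k}\mathcal F(\sigma),\qquad p_\tau\circ\delta^k=\sum_{j=0}^{k+1}(-1)^j\,\mathcal F(\sigma_j\to\tau)\circ p_{\sigma_j}\quad(\tau\in K^{k+1}),$$ where $p_\sigma$ is the projection to $\mathcal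 F(\sigma)$ and $\sigma_j=\tau\smallsetminus\{x_j\}$ for $\tau=\{x_0<\dots<x_{k+1}\}$ (for finite $K$ the product is the direct sum). An isomorphism $H^k(K,\mathcal F)\cong H^k(C^\bullet(K,\mathcal F))$ is called canonical if, for every injective resolution $\mathcal I^\bullet$ of $\mathcal F$, the augmentation $C^\bullet(K,\mathcal F)\to\mathrm{Tot}\,C^\bullet(K,\mathcal I^\bullet)$ induces an isomorphism on $H^k$, and the isomorphism is the one given by it and by $\Gamma(K,\mathcal I^\bullet)\to\mathrm{Tot}\,C^\bullet(K,\mathcal I^\bullet)$. Let $f:X\to Y$ be a simplicial map of abstract simplicial complexes, with linearly ordered vertex sets, and let $\mathcal F$ be a sheaf on $Y$. The map $H^k(f):H^k(Y,\mathcal F)\to H^k(X,f^*\mathcal F)$ is defined as follows: choose injective resolutions $\mathcal I^\bullet$ of $\mathcal F$ and $\mathcal J^\bullet$ of $f^*\mathcal F$ and a morphism of complexes $g:f^*\mathcal I^\bullet\to\mathcal J^\bullet$ that lifts the identity of $f^*\mathcal F$; then $H^k(f)$ is induced on cohomology by the composition $\Gamma(Y,\mathcal I^\bullet)\to\Gamma(X,f^*\mathcal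 I^\bullet)\to\Gamma(X,\mathcal J^\bullet)$ of the map given by the unit $\mathrm{id}\to f_*f^*$ and $\Gamma(X,g)$. Then: 1. For every simplex $\sigma$ of $X$ the canonical map $\mathcal F(f(\sigma))\to(f^*\mathcal F)(\sigma)$ is an isomorphism; identify both objects by it. 2. Such $\mathcal I^\bullet,\mathcal J^\bullet,g$ exist. 3. The maps $f^k:C^k(Y,\mathcal F)\to C^k(X,f^*\mathcal F)$ whose component at $\sigma=\{x_0<\dots<x_k\}\in X^k$ is $\varepsilon_f(\sigma)\,p_{f(\sigma)}$ form a morphism of cochain complexes $f^\bullet$. Here $\varepsilon_f(\sigma)$ is the sign of the permutation that puts $f(x_0),\dots,f(x_k)$ in increasing order (so it is $1$ if $f$ is order-preserving on $\sigma$), and the component is $0$ if $f(\sigma)$ has fewer than $k+1$ vertices. 4. There are canonical isomorphisms $H^k(Y,\mathcal F)\cong H^k(C^\bullet(Y,\mathcal F))$ and $H^k(X,f^*\mathcal F)\cong H^k(C^\bullet(X,f^*\mathcal F))$ for all $k\ge 0$, and under them $H^k(f)$, for any choice of $\mathcal I^\bullet,\mathcal J^\bullet,g$, is the map $H^k(f^\bullet)$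 induced by $f^\bullet$ on cohomology. -/

import Mathlib

open CategoryTheory CategoryTheory.Limits TopologicalSpace Opposite

universe u w

noncomputable section

namespace CellSheaf

section Space

variable {V : Type u}

/-- The set of simplices of an abstract simplicial complex, as a type. -/
@[ext]
structure Simplices (K : AbstractSimplicialComplex V) : Type u where
  verts : Finset V
  mem : verts ∈ K.faces

variable (K : AbstractSimplicialComplex V)

/-- The face relation poset. -/
instance : PartialOrder (Simplices K) :=
  PartialOrder.lift Simplices.verts fun _ _ => Simplices.ext

/-- The Alexandrov topology: the open sets are the upper sets of the face relation. -/
instance : TopologicalSpace (Simplices K) := Topology.upperSet (Simplices K)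

instance : Topology.IsUpperSet (Simplices K) := ⟨rfl⟩

/-- A simplicial complex as a topological space. -/
abbrev space : TopCat.{u} := TopCat.of (Simplices K)

variable {K}

/-- The basic open set `U_σ` of all cofaces of the simplex `σ`. -/
def star (σ : Simplices K) : Opens (space K) :=
  ⟨{τ | σ ≤ τ}, by
    rw [Topology.IsUpperSet.isOpen_iff_isUpperSet]
    exact fun _ _ h h' => le_trans h' h⟩

lemma star_le_star {σ τ : Simplices K} (h : σ ≤ τ) : star τ ≤ star σ :=
  fun _ h' => le_trans h h'

lemma star_le_of_mem {σ : Simplices K} {U : Opens (space K)} (h : σ ∈ U) : star σ ≤ U := by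
  have := U.isOpen
  rw [Topology.IsUpperSet.isOpen_iff_isUpperSet] at this
  exact fun _ h' => this h' h

/-! Sheafification on `space K`, for values in any complete category: the basic open sets form a
dense subsite with the trivial topology. It makes the category of sheaves abelian. -/

variable (K) in
/-- The functor `σ ↦ U_σ`. -/
def starFunctor : (Simplices K)ᵒᵖ ⥤ Opens (space K) where
  obj σ := star σ.unop
  map g := homOfLE (star_le_star g.unop.le)

instance : (starFunctor K).Full where
  map_surjective {σ τ} g := ⟨(homOfLE (show τ.unop ≤ σ.unop from g.le (le_refl σ.unop))).op, rfl⟩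

instance : (starFunctor K).Faithful where
  map_injective _ := Subsingleton.elim _ _

instance : (starFunctor K).IsCoverDense (Opens.grothendieckTopology (space K)) where
  is_cover U := fun σ hσ => ⟨star σ, homOfLE (star_le_of_mem hσ),
      ⟨⟨op σ, 𝟙 _, homOfLE (star_le_of_mem hσ), rfl⟩⟩, le_refl σ⟩

instance : (starFunctor K).IsDenseSubsite ⊥ (Opens.grothendieckTopology (space K)) where
  functorPushforward_mem_iff {σ S} := by
    rw [GrothendieckTopology.bot_covering]
    constructor
    · intro h
      obtain ⟨U, g, ⟨τ, a, b, ha, -⟩, hU⟩ := h σ.unop (show σ.unop ≤ σ.unop from le_refl _)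
      have hs : τ.unop ≤ σ.unop := b.le hU
      have h1 := S.downward_closed ha (homOfLE hs).op
      rw [← Sieve.id_mem_iff_eq_top]
      exact h1
    · rintro rfl
      exact fun τ hτ => ⟨star σ.unop, 𝟙 _, ⟨σ, 𝟙 _, 𝟙 _, trivial, by simp; rfl⟩, hτ⟩

instance {M : Type w} [Category.{u} M] [HasLimits M] :
    HasSheafify (Opens.grothendieckTopology (space K)) M :=
  Functor.IsDenseSubsite.hasSheafify_of_isEquivalence ⊥ _ (starFunctor K)

end Space

section SheafCohomology

variable {M : Type w} [Category.{u} M] [Abelian M] [IsGrothendieckAbelian.{u} M]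
variable {V : Type u} (K : AbstractSimplicialComplex V)

variable (M) in
/-- The global section functor `Γ(K, -)`. -/
def globalSections : (space K).Sheaf M ⥤ M :=
  TopCat.Sheaf.forget M (space K) ⋙ (evaluation (Opens (space K))ᵒᵖ M).obj (op ⊤)

instance : (globalSections M K).Additive where

variable {K} in
/-- Sheaf cohomology: the right derived functors of the global section functor. -/
def sheafCohomology (F : (space K).Sheaf M) (k : ℕ) : M :=
  ((globalSections M K).rightDerived k).obj F

end SheafCohomology

section CellularComplex

variable {M : Type w} [Category.{u} M] [Abelian M] [IsGrothendieckAbelian.{u} M]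
variable {V : Type u} [LinearOrder V]

/-- `(-1)^j`, where `v` is the `j`-th element of `s` in increasing order, counted from `0`. -/
def posSign (s : Finset V) (v : V) : ℤ := (-1) ^ (s.filter (· < v)).card

lemma posSign_swap {s : Finset V} {v w : V} (hv : v ∈ s) (hw : w ∈ s) (h : v ≠ w) :
    posSign s v * posSign (s.erase v) w + posSign s w * posSign (s.erase w) v = 0 := by
  wlog hlt : v < w generalizing v w
  · rw [add_comm]
    exact this hw hv h.symm (lt_of_le_of_ne (not_lt.1 hlt) h.symm)
  have h1 : ((s.erase w).filter (· < v)) = s.filter (· < v) := by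
    ext x; simp only [Finset.mem_filter, Finset.mem_erase]
    exact ⟨fun hx => ⟨hx.1.2, hx.2⟩, fun hx => ⟨⟨(hx.2.trans hlt).ne, hx.1⟩, hx.2⟩⟩
  have h2 : ((s.erase v).filter (· < w)) = (s.filter (· < w)).erase v := by
    ext x; simp only [Finset.mem_filter, Finset.mem_erase, and_assoc]
  have h3 : (((s.erase v).filter (· < w))).card + 1 = (s.filter (· < w)).card := by
    rw [h2, Finset.card_erase_add_one (by simp [hv, hlt])]
  simp only [posSign, h1, ← h3, pow_succ]
  ring

/-- The set `K^k` of `k`-simplices. -/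
@[ext]
structure KSimplex (K : AbstractSimplicialComplex V) (k : ℕ) : Type u where
  simplex : Simplices K
  card_eq : simplex.verts.card = k + 1

variable {K : AbstractSimplicialComplex V}

/-- The vertices of a `k`-simplex. -/
abbrev KSimplex.verts {k : ℕ} (σ : KSimplex K k) : Finset V := σ.simplex.verts

/-- The face of the `(k+1)`-simplex `τ` opposite to its vertex `v`. -/
def face {k : ℕ} (τ : KSimplex K (k + 1)) (v : τ.verts) : KSimplex K k :=
  have hc : (τ.verts.erase v.1).card = k + 1 := by
    rw [Finset.card_erase_of_mem v.2, τ.card_eq]; rfl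
  { simplex :=
      { verts := τ.verts.erase v.1
        mem := (K.isRelLowerSet_faces τ.simplex.mem).2 (Finset.erase_subset _ _)
          (Finset.card_pos.1 (by omega)) }
    card_eq := hc }

lemma face_le {k : ℕ} (τ : KSimplex K (k + 1)) (v : τ.verts) : (face τ v).simplex ≤ τ.simplex :=
  Finset.erase_subset _ _

variable (M) in
/-- The functor `F ↦ F(σ) := F(U_σ)`. -/
def sectionsAt (σ : Simplices K) : (space K).Sheaf M ⥤ M :=
  TopCat.Sheaf.forget M (space K) ⋙ (evaluation (Opens (space K))ᵒᵖ M).obj (op (star σ))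

instance (σ : Simplices K) : (sectionsAt M σ).Additive where

/-- The restriction map `F(σ → τ) : F(U_σ) ⟶ F(U_τ)` of the cellular sheaf defined by `F`. -/
def res (F : (space K).Sheaf M) {σ τ : Simplices K} (h : σ ≤ τ) :
    (sectionsAt M σ).obj F ⟶ (sectionsAt M τ).obj F :=
  F.presheaf.map (homOfLE (star_le_star h)).op

lemma res_comp (F : (space K).Sheaf M) {σ τ ρ : Simplices K} (h : σ ≤ τ) (h' : τ ≤ ρ) :
    res F h ≫ res F h' = res F (h.trans h') :=
  (F.presheaf.map_comp _ _).symm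

lemma res_naturality {F G : (space K).Sheaf M} (φ : F ⟶ G) {σ τ : Simplices K} (h : σ ≤ τ) :
    res F h ≫ (sectionsAt M τ).map φ = (sectionsAt M σ).map φ ≫ res G h :=
  ((TopCat.Sheaf.forget M (space K)).map φ).naturality _

/-- The cellular cochains `C^k(K, F)`: the product of the `F(σ)`, `σ ∈ K^k` (which is their direct
sum when `K` is finite). -/
def cochains (F : (space K).Sheaf M) (k : ℕ) : M :=
  ∏ᶜ fun σ : KSimplex K k => (sectionsAt M σ.simplex).obj F

/-- The projection `p_σ`. -/
def proj (F : (space K).Sheaf M) {k : ℕ} (σ : KSimplex K k) :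
    cochains F k ⟶ (sectionsAt M σ.simplex).obj F :=
  Pi.π (fun σ : KSimplex K k => (sectionsAt M σ.simplex).obj F) σ

/-- The morphism to `C^k(K, F)` with given components. -/
def liftCochains (F : (space K).Sheaf M) {k : ℕ} {A : M}
    (a : ∀ σ : KSimplex K k, A ⟶ (sectionsAt M σ.simplex).obj F) : A ⟶ cochains F k :=
  Pi.lift a

lemma liftCochains_proj (F : (space K).Sheaf M) {k : ℕ} {A : M}
    (a : ∀ σ : KSimplex K k, A ⟶ (sectionsAt M σ.simplex).obj F) (σ : KSimplex K k) :
    liftCochains F a ≫ proj F σ = a σ :=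
  Pi.lift_π a σ

lemma cochains_hom_ext {F : (space K).Sheaf M} {k : ℕ} {A : M} {a b : A ⟶ cochains F k}
    (h : ∀ σ, a ≫ proj F σ = b ≫ proj F σ) : a = b :=
  Pi.hom_ext _ _ h

lemma proj_res (F : (space K).Sheaf M) {k : ℕ} {σ σ' : KSimplex K k} (e : σ = σ')
    {ρ : Simplices K} (h : σ.simplex ≤ ρ) (h' : σ'.simplex ≤ ρ) :
    proj F σ ≫ res F h = proj F σ' ≫ res F h' := by
  subst e; rfl

/-- The coboundary `δ^k`: its component at `τ = (x_0 < ⋯ < x_{k+1})` is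
`∑ j, (-1)^j F(σ_j → τ) ∘ p_{σ_j}` with `σ_j` the face of `τ` opposite to `x_j`. -/
def coboundary (F : (space K).Sheaf M) (k : ℕ) : cochains F k ⟶ cochains F (k + 1) :=
  liftCochains F fun τ : KSimplex K (k + 1) =>
    ∑ v : τ.verts, posSign τ.verts v.1 • (proj F (face τ v) ≫ res F (face_le τ v))

lemma coboundary_proj (F : (space K).Sheaf M) (k : ℕ) (τ : KSimplex K (k + 1)) :
    coboundary F k ≫ proj F τ =
      ∑ v : τ.verts, posSign τ.verts v.1 • (proj F (face τ v) ≫ res F (face_le τ v)) :=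
  liftCochains_proj F _ τ

lemma coboundary_comp (F : (space K).Sheaf M) (k : ℕ) :
    coboundary F k ≫ coboundary F (k + 1) = 0 := by
  refine cochains_hom_ext fun ρ => ?_
  rw [Category.assoc, coboundary_proj, zero_comp, Preadditive.comp_sum]
  have (v : ρ.verts) : coboundary F k ≫ (posSign ρ.verts v.1 •
        (proj F (face ρ v) ≫ res F (face_le ρ v))) =
      ∑ w : (face ρ v).verts, (posSign ρ.verts v.1 * posSign (ρ.verts.erase v.1) w.1) •
        (proj F (face (face ρ v) w) ≫ res F ((face_le _ w).trans (face_le ρ v))) := by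
    rw [Preadditive.comp_zsmul, ← Category.assoc, coboundary_proj, Preadditive.sum_comp,
      Finset.smul_sum]
    refine Finset.sum_congr rfl fun w _ => ?_
    rw [Preadditive.zsmul_comp, Category.assoc, res_comp, smul_smul]
    rfl
  rw [Finset.sum_congr rfl fun v _ => this v, Finset.sum_sigma']
  have hm (a : (v : ρ.verts) × (face ρ v).verts) : a.2.1 ≠ a.1.1 ∧ a.2.1 ∈ ρ.verts :=
    Finset.mem_erase.1 a.2.2
  refine Finset.sum_involution
    (fun a _ => ⟨⟨a.2.1, (hm a).2⟩, ⟨a.1.1, Finset.mem_erase.2 ⟨(hm a).1.symm, a.1.2⟩⟩⟩)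
    ?_ ?_ (fun _ _ => by simp) (fun _ _ => rfl)
  · intro a _
    dsimp only
    have e : face (face ρ ⟨a.2.1, (hm a).2⟩) ⟨a.1.1, Finset.mem_erase.2 ⟨(hm a).1.symm, a.1.2⟩⟩ =
        face (face ρ a.1) a.2 :=
      KSimplex.ext (Simplices.ext Finset.erase_right_comm)
    rw [proj_res F e _ ((face_le _ _).trans (face_le _ _)), ← add_smul,
      posSign_swap a.1.2 (hm a).2 (hm a).1.symm, zero_smul]
  · intro a _ _ h
    exact (hm a).1 (congrArg (fun b => b.1.1) h)

/-- The cellular cochain complex `C^•(K, F)`. -/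
def cellularComplex (F : (space K).Sheaf M) : CochainComplex M ℕ :=
  CochainComplex.of (cochains F) (coboundary F) (coboundary_comp F)

lemma cellularComplex_d (F : (space K).Sheaf M) (k : ℕ) :
    (cellularComplex F).d k (k + 1) = coboundary F k :=
  CochainComplex.of_d _ _ k

/-- The morphism `C^k(K, F) ⟶ C^k(K, G)` induced by `φ : F ⟶ G`. -/
def cochainsMap {F G : (space K).Sheaf M} (φ : F ⟶ G) (k : ℕ) : cochains F k ⟶ cochains G k :=
  liftCochains G fun σ => proj F σ ≫ (sectionsAt M σ.simplex).map φ

lemma cochainsMap_proj {F G : (space K).Sheaf M} (φ : F ⟶ G) {k : ℕ} (σ : KSimplex K k) :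
    cochainsMap φ k ≫ proj G σ = proj F σ ≫ (sectionsAt M σ.simplex).map φ :=
  liftCochains_proj G _ σ

lemma cochainsMap_coboundary {F G : (space K).Sheaf M} (φ : F ⟶ G) (k : ℕ) :
    cochainsMap φ k ≫ coboundary G k = coboundary F k ≫ cochainsMap φ (k + 1) := by
  refine cochains_hom_ext fun τ => ?_
  rw [Category.assoc, Category.assoc, cochainsMap_proj, coboundary_proj, ← Category.assoc,
    coboundary_proj, Preadditive.comp_sum, Preadditive.sum_comp]
  refine Finset.sum_congr rfl fun v _ => ?_
  rw [Preadditive.comp_zsmul, Preadditive.zsmul_comp, ← Category.assoc, cochainsMap_proj,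
    Category.assoc, Category.assoc, res_naturality]

lemma cochainsMap_id (F : (space K).Sheaf M) (k : ℕ) :
    cochainsMap (𝟙 F) k = 𝟙 (cochains F k) :=
  cochains_hom_ext fun σ => by
    rw [cochainsMap_proj, CategoryTheory.Functor.map_id, Category.comp_id, Category.id_comp]

lemma cochainsMap_comp {F G H : (space K).Sheaf M} (φ : F ⟶ G) (ψ : G ⟶ H) (k : ℕ) :
    cochainsMap (φ ≫ ψ) k = cochainsMap φ k ≫ cochainsMap ψ k :=
  cochains_hom_ext fun σ => by
    rw [Category.assoc, cochainsMap_proj, cochainsMap_proj, ← Category.assoc, cochainsMap_proj,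
      Functor.map_comp, Category.assoc]

lemma cochainsMap_add {F G : (space K).Sheaf M} (φ ψ : F ⟶ G) (k : ℕ) :
    cochainsMap (φ + ψ) k = cochainsMap φ k + cochainsMap ψ k :=
  cochains_hom_ext fun σ => by
    rw [Preadditive.add_comp, cochainsMap_proj, cochainsMap_proj, cochainsMap_proj,
      Functor.map_add, Preadditive.comp_add]

variable (M K) in
/-- The cellular cochain complex as a functor of the sheaf. -/
def cellularFunctor : (space K).Sheaf M ⥤ CochainComplex M ℕ where
  obj F := cellularComplex F
  map {F G} φ :=
    { f := cochainsMap φ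
      comm' := by
        rintro i _ rfl
        rw [cellularComplex_d, cellularComplex_d]
        exact cochainsMap_coboundary φ i }
  map_id F := HomologicalComplex.hom_ext _ _ fun k => cochainsMap_id F k
  map_comp φ ψ := HomologicalComplex.hom_ext _ _ fun k => cochainsMap_comp φ ψ k

instance : (cellularFunctor M K).Additive where
  map_add := HomologicalComplex.hom_ext _ _ fun k => cochainsMap_add _ _ k

end CellularComplex

section Comparison

variable {M : Type w} [Category.{u} M] [Abelian M] [IsGrothendieckAbelian.{u} M]
variable {V : Type u} [LinearOrder V] {K : AbstractSimplicialComplex V}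

/-- The sign `(-1)^p` for total complexes of bicomplexes indexed by `ℕ × ℕ`. -/
instance : ComplexShape.TensorSigns (ComplexShape.up ℕ) where
  ε' := MonoidHom.mk' (fun i : Multiplicative ℕ => (-1 : ℤˣ) ^ (Multiplicative.toAdd i))
    fun a b => pow_add (-1 : ℤˣ) _ _
  rel_add p q r h := by
    have h : p + 1 = q := h
    show p + r + 1 = q + r
    omega
  add_rel p q r h := by
    have h : p + 1 = q := h
    show r + p + 1 = r + q
    omega
  ε'_succ p q h := by
    have h : p + 1 = q := h
    subst h
    show (-1 : ℤˣ) ^ (p + 1) = -(-1) ^ p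
    rw [pow_succ, mul_neg_one]

instance (B : HomologicalComplex₂ M (ComplexShape.up ℕ) (ComplexShape.up ℕ)) :
    B.HasTotal (ComplexShape.up ℕ) := fun n => by
  have : Finite ((ComplexShape.π (ComplexShape.up ℕ) (ComplexShape.up ℕ)
      (ComplexShape.up ℕ)) ⁻¹' {n}) := by
    refine (((Finset.range (n + 1)) ×ˢ (Finset.range (n + 1))).finite_toSet.subset ?_).to_subtype
    rintro ⟨p, q⟩ h
    have h : p + q = n := h
    simp
    omega
  infer_instance

/-- The double complex `C^q(K, I^p)` of a resolution `I` of `F`. -/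
def bicomplex {F : (space K).Sheaf M} (I : InjectiveResolution F) :
    HomologicalComplex₂ M (ComplexShape.up ℕ) (ComplexShape.up ℕ) :=
  ((cellularFunctor M K).mapHomologicalComplex (ComplexShape.up ℕ)).obj I.cocomplex

/-- The total complex of the double complex `C^q(K, I^p)`. -/
def totalComplex {F : (space K).Sheaf M} (I : InjectiveResolution F) : CochainComplex M ℕ :=
  (bicomplex I).total (ComplexShape.up ℕ)

/-- The inclusion of `C^q(K, I^p)` in the total complex. -/
def ι {F : (space K).Sheaf M} (I : InjectiveResolution F) (p q n : ℕ) (h : p + q = n) :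
    cochains (I.cocomplex.X p) q ⟶ (totalComplex I).X n :=
  (bicomplex I).ιTotal (ComplexShape.up ℕ) p q n h

lemma ι_d {F : (space K).Sheaf M} (I : InjectiveResolution F) (p q n : ℕ) (h : p + q = n) :
    ι I p q n h ≫ (totalComplex I).d n (n + 1) =
      cochainsMap (I.cocomplex.d p (p + 1)) q ≫ ι I (p + 1) q (n + 1) (by omega) +
        (-1 : ℤˣ) ^ p • (coboundary (I.cocomplex.X p) q ≫ ι I p (q + 1) (n + 1) (by omega)) := by
  have h1 := HomologicalComplex₂.d₁_eq (bicomplex I) (ComplexShape.up ℕ)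
    (show (ComplexShape.up ℕ).Rel p (p + 1) from rfl) q (n + 1) (show p + 1 + q = n + 1 by omega)
  have h2 := HomologicalComplex₂.d₂_eq (bicomplex I) (ComplexShape.up ℕ) p
    (show (ComplexShape.up ℕ).Rel q (q + 1) from rfl) (n + 1) (show p + (q + 1) = n + 1 by omega)
  have h3 := ((bicomplex I).ι_D₁ (ComplexShape.up ℕ) n (n + 1) p q h).trans h1
  have h4 := ((bicomplex I).ι_D₂ (ComplexShape.up ℕ) n (n + 1) p q h).trans h2
  refine (Preadditive.comp_add _ _ _ _ _ _).trans ?_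
  refine congrArg₂ (· + ·) (h3.trans (one_smul _ _)) (h4.trans ?_)
  rw [← cellularComplex_d]
  rfl

lemma cochainsMap_zero (F G : (space K).Sheaf M) (k : ℕ) :
    cochainsMap (0 : F ⟶ G) k = 0 :=
  cochains_hom_ext fun σ => by
    rw [cochainsMap_proj, Functor.map_zero, comp_zero, zero_comp]

/-- The augmentation `F ⟶ I^0` of a resolution. -/
def unitMap {F : (space K).Sheaf M} (I : InjectiveResolution F) : F ⟶ I.cocomplex.X 0 :=
  I.ι.f 0

lemma unitMap_d {F : (space K).Sheaf M} (I : InjectiveResolution F) :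
    unitMap I ≫ I.cocomplex.d 0 1 = 0 :=
  I.ι_f_zero_comp_complex_d

lemma unitMap_ι_d {F : (space K).Sheaf M} (I : InjectiveResolution F) (k : ℕ) :
    (cochainsMap (unitMap I) k ≫ ι I 0 k k (zero_add k)) ≫ (totalComplex I).d k (k + 1) =
      coboundary F k ≫ cochainsMap (unitMap I) (k + 1) ≫ ι I 0 (k + 1) (k + 1) (zero_add _) := by
  rw [Category.assoc, ι_d, Preadditive.comp_add, ← Category.assoc, ← cochainsMap_comp]
  rw [unitMap_d, cochainsMap_zero, zero_comp, zero_add, pow_zero, one_smul,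
    ← Category.assoc, ← Category.assoc, cochainsMap_coboundary]

/-- The morphism `C^•(K, F) ⟶ Tot C^•(K, I^•)` given by the augmentation `F ⟶ I^0`. -/
def cellularToTotal {F : (space K).Sheaf M} (I : InjectiveResolution F) :
    cellularComplex F ⟶ totalComplex I where
  f k := cochainsMap (unitMap I) k ≫ ι I 0 k k (zero_add k)
  comm' := by
    rintro k _ rfl
    rw [cellularComplex_d]
    exact unitMap_ι_d I k

/-- The restriction map `Γ(K, F) ⟶ F(σ)`. -/
def resTop (F : (space K).Sheaf M) (σ : Simplices K) :
    (globalSections M K).obj F ⟶ (sectionsAt M σ).obj F :=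
  F.presheaf.map (homOfLE (le_top : star σ ≤ ⊤)).op

lemma resTop_res (F : (space K).Sheaf M) {σ τ : Simplices K} (h : σ ≤ τ) :
    resTop F σ ≫ res F h = resTop F τ :=
  (F.presheaf.map_comp _ _).symm

lemma resTop_naturality {F G : (space K).Sheaf M} (φ : F ⟶ G) (σ : Simplices K) :
    resTop F σ ≫ (sectionsAt M σ).map φ = (globalSections M K).map φ ≫ resTop G σ :=
  ((TopCat.Sheaf.forget M (space K)).map φ).naturality _

/-- The morphism `Γ(K, F) ⟶ C^0(K, F)` given by the restrictions to the `U_x`, `x` a vertex. -/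
def augmentation (F : (space K).Sheaf M) : (globalSections M K).obj F ⟶ cochains F 0 :=
  liftCochains F fun σ => resTop F σ.simplex

lemma augmentation_proj (F : (space K).Sheaf M) (σ : KSimplex K 0) :
    augmentation F ≫ proj F σ = resTop F σ.simplex :=
  liftCochains_proj F _ σ

lemma augmentation_naturality {F G : (space K).Sheaf M} (φ : F ⟶ G) :
    (globalSections M K).map φ ≫ augmentation G = augmentation F ≫ cochainsMap φ 0 :=
  cochains_hom_ext fun σ => by
    rw [Category.assoc, Category.assoc, cochainsMap_proj, augmentation_proj, ← Category.assoc,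
      augmentation_proj, resTop_naturality]

lemma augmentation_coboundary (F : (space K).Sheaf M) :
    augmentation F ≫ coboundary F 0 = 0 := by
  refine cochains_hom_ext fun τ => ?_
  have hr (v : τ.verts) : augmentation F ≫ (posSign τ.verts v.1 •
      (proj F (face τ v) ≫ res F (face_le τ v))) = posSign τ.verts v.1 •
        resTop F τ.simplex := by
    rw [Preadditive.comp_zsmul, ← Category.assoc, augmentation_proj, resTop_res]
  rw [Category.assoc, coboundary_proj, zero_comp, Preadditive.comp_sum,
    Finset.sum_congr rfl fun v _ => hr v, ← Finset.sum_smul]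
  obtain ⟨a, b, hab, he'⟩ := Finset.card_eq_two.1 τ.card_eq
  have he : τ.verts = {a, b} := he'
  have h1 : ∑ v : τ.verts, posSign τ.verts v.1 = ∑ v ∈ τ.verts, posSign τ.verts v :=
    Finset.sum_coe_sort τ.verts (posSign τ.verts)
  have h2 : ∑ v ∈ τ.verts, posSign τ.verts v = 0 := by
    have h3 := posSign_swap (s := τ.verts) (v := a) (w := b) (by simp [he]) (by simp [he]) hab
    have h4 : posSign (τ.verts.erase a) b = 1 := by
      have : τ.verts.erase a = {b} := by rw [he]; simp [hab]
      simp [posSign, this, Finset.filter_singleton]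
    have h5 : posSign (τ.verts.erase b) a = 1 := by
      have : τ.verts.erase b = {a} := by rw [he, Finset.pair_comm]; simp [hab.symm]
      simp [posSign, this, Finset.filter_singleton]
    rw [h4, h5, mul_one, mul_one] at h3
    conv_lhs => rw [he]
    rw [Finset.sum_pair hab, ← he]
    exact h3
  rw [h1, h2, zero_smul]

lemma augmentation_ι_d {F : (space K).Sheaf M} (I : InjectiveResolution F) (k : ℕ) :
    (augmentation (I.cocomplex.X k) ≫ ι I k 0 k (add_zero k)) ≫ (totalComplex I).d k (k + 1) =
      (globalSections M K).map (I.cocomplex.d k (k + 1)) ≫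
        augmentation (I.cocomplex.X (k + 1)) ≫ ι I (k + 1) 0 (k + 1) (add_zero _) := by
  rw [Category.assoc, ι_d, Preadditive.comp_add, ← Category.assoc, ← augmentation_naturality,
    Linear.comp_units_smul, ← Category.assoc (augmentation _), augmentation_coboundary,
    zero_comp, smul_zero, add_zero, Category.assoc]

/-- The morphism `Γ(K, I^•) ⟶ Tot C^•(K, I^•)` given by the augmentations. -/
def sectionsToTotal {F : (space K).Sheaf M} (I : InjectiveResolution F) :
    ((globalSections M K).mapHomologicalComplex _).obj I.cocomplex ⟶ totalComplex I where
  f k := augmentation (I.cocomplex.X k) ≫ ι I k 0 k (add_zero k)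
  comm' := by
    rintro k _ rfl
    exact augmentation_ι_d I k

end Comparison

section Canonical

variable {M : Type w} [Category.{u} M] [Abelian M] [IsGrothendieckAbelian.{u} M]
variable {V : Type u} [LinearOrder V] {K : AbstractSimplicialComplex V}

/-- An isomorphism of `H^k(K, F)` with the cohomology of the cellular cochain complex is canonical
if it is the one given by the quasi-isomorphisms `Γ(K, I^•) ⟶ Tot C^•(K, I^•) ⟵ C^•(K, F)` for all
injective resolutions `I^•` of `F`. -/
def IsCanonical (F : (space K).Sheaf M) (k : ℕ)
    (e : sheafCohomology F k ≅ (cellularComplex F).homology k) : Prop :=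
  ∀ I : InjectiveResolution F,
    IsIso (HomologicalComplex.homologyMap (cellularToTotal I) k) ∧
    e.hom ≫ HomologicalComplex.homologyMap (cellularToTotal I) k =
      (I.isoRightDerivedObj (globalSections M K) k).hom ≫
        HomologicalComplex.homologyMap (sectionsToTotal I) k

end Canonical

section SimplicialMaps

variable {V W : Type u} [LinearOrder V] [LinearOrder W]

/-- A simplicial map: a map of the vertices such that the image of a simplex is a simplex. -/
structure SimplicialMap (X : AbstractSimplicialComplex V) (Y : AbstractSimplicialComplex W) where
  toFun : V → W
  map_mem : ∀ σ ∈ X.faces, σ.image toFun ∈ Y.faces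

variable {X : AbstractSimplicialComplex V} {Y : AbstractSimplicialComplex W}

/-- The map of simplices given by a simplicial map. -/
def SimplicialMap.onSimplices (f : SimplicialMap X Y) (σ : Simplices X) : Simplices Y where
  verts := σ.verts.image f.toFun
  mem := f.map_mem _ σ.mem

lemma SimplicialMap.monotone (f : SimplicialMap X Y) : Monotone f.onSimplices :=
  fun _ _ h => Finset.image_subset_image h

/-- The continuous map given by a simplicial map. -/
def SimplicialMap.onSpace (f : SimplicialMap X Y) : space X ⟶ space Y :=
  TopCat.ofHom ⟨f.onSimplices, Topology.IsUpperSet.monotone_iff_continuous.1 f.monotone⟩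

variable {M : Type w} [Category.{u} M] [Abelian M] [IsGrothendieckAbelian.{u} M]

lemma opensMap_isContinuous {A B : TopCat.{u}} (g : A ⟶ B) :
    (Opens.map g).IsContinuous (Opens.grothendieckTopology B) (Opens.grothendieckTopology A) :=
  inferInstance

lemma pushforward_isRightAdjoint {A B : TopCat.{u}} (g : A ⟶ B)
    [HasWeakSheafify (Opens.grothendieckTopology A) M] :
    (TopCat.Sheaf.pushforward M g).IsRightAdjoint :=
  inferInstanceAs ((Opens.map g).sheafPushforwardContinuous M (Opens.grothendieckTopology B)
    (Opens.grothendieckTopology A)).IsRightAdjoint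

instance (f : SimplicialMap X Y) : (TopCat.Sheaf.pushforward M f.onSpace).IsRightAdjoint :=
  pushforward_isRightAdjoint f.onSpace

variable (M) in
/-- The inverse image functor `f^*` of sheaves. -/
def pullback (f : SimplicialMap X Y) : (space Y).Sheaf M ⥤ (space X).Sheaf M :=
  (TopCat.Sheaf.pushforward M f.onSpace).leftAdjoint

variable (M) in
/-- The adjunction `f^* ⊣ f_*`. -/
def pullbackAdjunction (f : SimplicialMap X Y) :
    pullback M f ⊣ TopCat.Sheaf.pushforward M f.onSpace :=
  Adjunction.ofIsRightAdjoint _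

instance (f : SimplicialMap X Y) : (pullback M f).IsLeftAdjoint :=
  (pullbackAdjunction M f).isLeftAdjoint

instance (f : SimplicialMap X Y) : (TopCat.Sheaf.pushforward M f.onSpace).Additive where

instance (f : SimplicialMap X Y) : (pullback M f).Additive :=
  (pullbackAdjunction M f).left_adjoint_additive

/-- The map `F(U) ⟶ (f^*F)(U')`, for `f(U') ⊆ U`, given by the unit `F ⟶ f_*f^*F`. -/
def sectionMap (f : SimplicialMap X Y) (F : (space Y).Sheaf M) {U : Opens (space Y)}
    {U' : Opens (space X)} (h : U' ≤ (Opens.map f.onSpace).obj U) :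
    F.presheaf.obj (op U) ⟶ ((pullback M f).obj F).presheaf.obj (op U') :=
  ((TopCat.Sheaf.forget M (space Y)).map ((pullbackAdjunction M f).unit.app F)).app (op U) ≫
    ((pullback M f).obj F).presheaf.map (homOfLE h).op

lemma sectionMap_naturality (f : SimplicialMap X Y) {F G : (space Y).Sheaf M} (φ : F ⟶ G)
    {U : Opens (space Y)} {U' : Opens (space X)} (h : U' ≤ (Opens.map f.onSpace).obj U) :
    ((TopCat.Sheaf.forget M (space Y)).map φ).app (op U) ≫ sectionMap f G h =
      sectionMap f F h ≫
        ((TopCat.Sheaf.forget M (space X)).map ((pullback M f).map φ)).app (op U') := by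
  have h1 := congrArg (fun ψ => ((TopCat.Sheaf.forget M (space Y)).map ψ).app (op U))
    ((pullbackAdjunction M f).unit.naturality φ)
  have h2 := ((TopCat.Sheaf.forget M (space X)).map ((pullback M f).map φ)).naturality
    (homOfLE h).op
  refine (Category.assoc _ _ _).symm.trans ((congrArg (· ≫ _) h1).trans ?_)
  refine (Category.assoc _ _ _).trans ((congrArg (_ ≫ ·) h2.symm).trans ?_)
  exact (Category.assoc _ _ _).symm

variable (M) in
/-- The natural map `Γ(Y, F) ⟶ Γ(X, f^*F)`. -/
def globalSectionsMap (f : SimplicialMap X Y) :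
    globalSections M Y ⟶ pullback M f ⋙ globalSections M X where
  app F := sectionMap f F (U := ⊤) (U' := ⊤) fun _ _ => trivial
  naturality _ _ φ := sectionMap_naturality f φ _

/-- Data for the computation of `H^k(f)`: injective resolutions `I^•` of `F` and `J^•` of `f^*F`, and
a morphism of complexes `f^*I^• ⟶ J^•` that lifts the identity of `f^*F`. -/
structure InducedMapData (f : SimplicialMap X Y) (F : (space Y).Sheaf M) where
  I : InjectiveResolution F
  J : InjectiveResolution ((pullback M f).obj F)
  g : ((pullback M f).mapHomologicalComplex _).obj I.cocomplex ⟶ J.cocomplex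
  comm : (pullback M f).map (unitMap I) ≫ g.f 0 = unitMap J

/-- The map `H^k(f) : H^k(Y, F) ⟶ H^k(X, f^*F)`: on cohomology, the composition
`Γ(Y, I^•) ⟶ Γ(X, f^*I^•) ⟶ Γ(X, J^•)`. -/
def InducedMapData.inducedMap {f : SimplicialMap X Y} {F : (space Y).Sheaf M}
    (D : InducedMapData f F) (k : ℕ) :
    sheafCohomology F k ⟶ sheafCohomology ((pullback M f).obj F) k :=
  (D.I.isoRightDerivedObj (globalSections M Y) k).hom ≫
    HomologicalComplex.homologyMap
      ((NatTrans.mapHomologicalComplex (globalSectionsMap M f) _).app D.I.cocomplex ≫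
        ((globalSections M X).mapHomologicalComplex _).map D.g) k ≫
    (D.J.isoRightDerivedObj (globalSections M X) k).inv

/-- The canonical map `F(f(σ)) ⟶ (f^*F)(σ)`. -/
def stalkMap (f : SimplicialMap X Y) (F : (space Y).Sheaf M) (σ : Simplices X) :
    (sectionsAt M (f.onSimplices σ)).obj F ⟶ (sectionsAt M σ).obj ((pullback M f).obj F) :=
  sectionMap f F (U := star (f.onSimplices σ)) (U' := star σ) fun _ h => f.monotone h

/-- The sign of the permutation that puts `f(x_0), …, f(x_k)` in increasing order, for
`s = {x_0 < ⋯ < x_k}`: `(-1)` to the number of inversions. -/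
def mapSign (f : SimplicialMap X Y) (s : Finset V) : ℤ :=
  (-1) ^ ((s ×ˢ s).filter fun a => a.1 < a.2 ∧ f.toFun a.2 < f.toFun a.1).card

/-- The map `f^k = ∏_σ ±p_{f(σ)} : C^k(Y, F) ⟶ C^k(X, f^*F)`. Its component at `σ` is zero if `f(σ)`
is not a `k`-simplex. -/
def cellMap (f : SimplicialMap X Y) (F : (space Y).Sheaf M) (k : ℕ) :
    cochains F k ⟶ cochains ((pullback M f).obj F) k :=
  liftCochains _ fun σ =>
    if h : (f.onSimplices σ.simplex).verts.card = k + 1 then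
      mapSign f σ.verts • (proj F ⟨f.onSimplices σ.simplex, h⟩ ≫ stalkMap f F σ.simplex)
    else 0

end SimplicialMaps

end CellSheaf

end

/-! Sheaf and cellular cohomology are compared through the double complex `C^q(K, I^p)` of an
injective resolution. In the direction of `p` it is exact in positive degrees with kernel `C^q(K,
F)`, because taking sections over a star is exact and so are products (`cochainsMap_exact`). In the
direction of `q` it is exact in positive degrees with kernel `Γ(K, I^p)` (`coboundary_exact`,
`augmentation_exact`). A staircase argument, `Bigrading.IsAugmentation.isIso_homologyMap`, applied
to the double complex and to its transpose, turns both augmentations into quasi-isomorphisms.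

Exactness in the direction of `q` comes from contracting the cochains of each simplex `ρ` to its
least vertex. This vertex changes with `ρ`, so the homotopy does not respect restriction maps and
takes values in the sheaf of products of stalks. An injective sheaf is a retract of that sheaf,
which brings the homotopy back.

For a simplicial map `f`, the object `F(f(σ))` has the universal property of `(f^*F)(σ)`: both
represent morphisms from `F` to skyscrapers at `f(σ)` (`isIso_stalkMap`). Hence `f^*` is exact,
`f^*I^•` is a resolution of `f^*F`, and it maps to any injective resolution `J^•`. A count of
inversions (`mapSign_mul_erase`) shows that the signed maps `f^k` commute with the coboundaries.
Being natural in the sheaf, they combine with `f^*I^• ⟶ J^•` to a morphism of total complexes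
compatible with both augmentations (`exists_totalMap_cellMap`), and the comparison of the two maps
on cohomology is then a diagram chase. -/

noncomputable section

namespace CellSheaf

/-! ### First quadrant double complexes with exact rows. -/

section Bigraded

variable {M : Type w} [Category.{u} M] [Abelian M]

/-- A decomposition of a cochain complex as the total complex of a first quadrant double complex,
with the differentials `a` and `b` (signs included). -/
structure Bigrading (T : CochainComplex M ℕ) (B : ℕ → ℕ → M) where
  ι (p q n : ℕ) (h : p + q = n) : B p q ⟶ T.X n
  π (p q n : ℕ) (h : p + q = n) : T.X n ⟶ B p q
  ι_π_self (p q n : ℕ) (h : p + q = n) : ι p q n h ≫ π p q n h = 𝟙 _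
  ι_π_ne (p q p' q' n : ℕ) (h : p + q = n) (h' : p' + q' = n) (hp : p ≠ p') :
    ι p q n h ≫ π p' q' n h' = 0
  hom_ext {A : M} {n : ℕ} (x y : A ⟶ T.X n) (h : ∀ p q h, x ≫ π p q n h = y ≫ π p q n h) : x = y
  a (p q : ℕ) : B p q ⟶ B (p + 1) q
  b (p q : ℕ) : B p q ⟶ B p (q + 1)
  d_π_left (n : ℕ) : T.d n (n + 1) ≫ π (n + 1) 0 (n + 1) rfl = π n 0 n rfl ≫ a n 0
  d_π_right (n : ℕ) :
    T.d n (n + 1) ≫ π 0 (n + 1) (n + 1) (zero_add _) = π 0 n n (zero_add _) ≫ b 0 n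
  d_π (p q n : ℕ) (h : p + q + 1 = n) :
    T.d n (n + 1) ≫ π (p + 1) (q + 1) (n + 1) (by omega) =
      π p (q + 1) n (by omega) ≫ a p (q + 1) + π (p + 1) q n (by omega) ≫ b (p + 1) q

namespace Bigrading

variable {T : CochainComplex M ℕ} {B : ℕ → ℕ → M}

/-- Interchange of rows and columns. -/
def swap (D : Bigrading T B) : Bigrading T fun p q => B q p where
  ι p q n h := D.ι q p n (by omega)
  π p q n h := D.π q p n (by omega)
  ι_π_self p q n h := D.ι_π_self q p n _
  ι_π_ne p q p' q' n h h' hp := D.ι_π_ne q p q' p' n _ _ (by omega)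
  hom_ext x y h := D.hom_ext x y fun p q hpq => h q p (by omega)
  a p q := D.b q p
  b p q := D.a q p
  d_π_left n := D.d_π_right n
  d_π_right n := D.d_π_left n
  d_π p q n h := (D.d_π q p n (by omega)).trans (add_comm (_ : _ ⟶ _) _)

variable (D : Bigrading T B)

/-- If `x` has no component in the columns `> p` of the double complex, then the component of its
coboundary in the column `p + 1` is given by the horizontal differential. -/
lemma comp_d_π {A : M} {p q n : ℕ} (h : p + q = n) (x : A ⟶ T.X n)
    (hx : ∀ q' (h' : p + 1 + q' = n), x ≫ D.π (p + 1) q' n h' = 0) :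
    x ≫ T.d n (n + 1) ≫ D.π (p + 1) q (n + 1) (by omega) = x ≫ D.π p q n h ≫ D.a p q := by
  obtain _ | q := q
  · obtain rfl : p = n := by omega
    rw [D.d_π_left]
  · rw [D.d_π p q n (by omega), Preadditive.comp_add, ← Category.assoc x (D.π (p + 1) q n _),
      hx, zero_comp, add_zero]

/-- The horizontal complexes are exact in positive degrees, up to refinements. -/
def RowsExact : Prop :=
  ∀ (p q : ℕ) ⦃A : M⦄ (x : A ⟶ B (p + 1) q), x ≫ D.a (p + 1) q = 0 →
    ∃ (A' : M) (π : A' ⟶ A) (_ : Epi π) (y : A' ⟶ B p q), π ≫ x = y ≫ D.a p q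

variable {E : CochainComplex M ℕ} (α : E ⟶ T) (e : ∀ q, E.X q ⟶ B 0 q)

/-- The complex `E` augments the horizontal complexes. -/
structure IsAugmentation : Prop where
  eq (n : ℕ) : α.f n = e n ≫ D.ι 0 n n (zero_add n)
  mono (n : ℕ) : Mono (e n)
  exact (q : ℕ) ⦃A : M⦄ (x : A ⟶ B 0 q) : x ≫ D.a 0 q = 0 →
    ∃ (A' : M) (π : A' ⟶ A) (_ : Epi π) (y : A' ⟶ E.X q), π ≫ x = y ≫ e q

variable {D α e}

lemma IsAugmentation.mono_f (h : D.IsAugmentation α e) (n : ℕ) : Mono (α.f n) := by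
  have := h.mono n
  have : Mono (D.ι 0 n n (zero_add n)) := mono_of_mono_fac (D.ι_π_self 0 n n (zero_add n))
  rw [h.eq]
  infer_instance

/-- Here `z` lives in column `0` only, and the component of `dz` in column `1` is the horizontal
differential of `z`. As it vanishes, exactness at column `0` applies. -/
lemma IsAugmentation.lift (h : D.IsAugmentation α e) {n : ℕ} {A : M} (z : A ⟶ T.X n)
    (hz : ∀ p q hpq, z ≫ D.π (p + 1) q n hpq = 0)
    (hd : ∀ p q hpq, (z ≫ T.d n (n + 1)) ≫ D.π (p + 1) q (n + 1) hpq = 0) :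
    ∃ (A' : M) (π : A' ⟶ A) (_ : Epi π) (x : A' ⟶ E.X n), π ≫ z = x ≫ α.f n := by
  have h0 := D.comp_d_π (zero_add n) z (hz 0)
  rw [← Category.assoc, hd, ← Category.assoc] at h0
  obtain ⟨A', π, hπ, x, hx⟩ := h.exact n _ h0.symm
  refine ⟨A', π, hπ, x, D.hom_ext _ _ fun p q hpq => ?_⟩
  rw [h.eq]
  obtain _ | p := p
  · obtain rfl : q = n := by omega
    rw [Category.assoc, hx, Category.assoc, Category.assoc, D.ι_π_self, Category.comp_id]
  · rw [Category.assoc, hz, comp_zero, Category.assoc, Category.assoc,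
      D.ι_π_ne _ _ _ _ _ _ _ (by omega), comp_zero, comp_zero]

/-- The staircase argument, by induction on the last column `m` that meets the support: the entry
there is horizontally closed, hence horizontally exact, and subtracting a coboundary moves the
support one column to the left. -/
lemma IsAugmentation.lift_of_support (h : D.IsAugmentation α e) (hD : D.RowsExact) (n m : ℕ) :
    ∀ {A : M} (z : A ⟶ T.X (n + 1))
    (_ : ∀ p q hpq, m < p → z ≫ D.π p q (n + 1) hpq = 0)
    (_ : ∀ p q hpq, (z ≫ T.d (n + 1) (n + 2)) ≫ D.π (p + 1) q (n + 2) hpq = 0),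
    ∃ (A' : M) (π : A' ⟶ A) (_ : Epi π) (x : A' ⟶ E.X (n + 1)) (y : A' ⟶ T.X n),
      π ≫ z = x ≫ α.f (n + 1) + y ≫ T.d n (n + 1) := by
  induction m with
  | zero =>
    intro A z hz hd
    obtain ⟨A', π, hπ, x, hx⟩ := h.lift z (fun p q hpq => hz _ _ _ (by omega)) hd
    exact ⟨A', π, hπ, x, 0, by rw [hx, zero_comp, add_zero]⟩
  | succ m ih =>
    intro A z hz hd
    -- If `n < m`, the column `m + 1` contains no entry of total degree `n + 1`.
    by_cases hm : n < m
    · exact ih z (fun p q hpq _ => by omega) hd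
    obtain ⟨q, rfl⟩ := Nat.exists_eq_add_of_le (not_lt.1 hm)
    have h0 := D.comp_d_π (p := m + 1) (q := q) (by omega) z
      fun q' h' => hz _ _ _ (by omega)
    rw [← Category.assoc, hd, ← Category.assoc] at h0
    obtain ⟨A₁, π₁, hπ₁, y, hy⟩ := hD m q _ h0.symm
    have hy' := D.comp_d_π (p := m) (q := q) rfl (y ≫ D.ι m q (m + q) rfl) fun q' h' => by
      rw [Category.assoc, D.ι_π_ne _ _ _ _ _ _ _ (by omega), comp_zero]
    rw [Category.assoc, Category.assoc, ← Category.assoc (D.ι _ _ _ _) (D.π _ _ _ _), D.ι_π_self,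
      Category.id_comp] at hy'
    -- The coboundary of an element at position `(m, q)` has components in the columns `m` and `m +
    -- 1` only. The second one is `y ≫ D.a m q`, which cancels the last entry of `z`.
    obtain ⟨A₂, π₂, hπ₂, x, t, hx⟩ :=
      ih (π₁ ≫ z - (y ≫ D.ι m q (m + q) rfl) ≫ T.d (m + q) (m + q + 1)) (fun p q' hpq hp => by
        rw [Preadditive.sub_comp, Category.assoc, Category.assoc, Category.assoc]
        obtain rfl | hp' := eq_or_ne p (m + 1)
        · obtain rfl : q' = q := by omega
          rw [hy, hy', sub_self]
        · obtain ⟨p, rfl⟩ : ∃ p', p = p' + 1 := ⟨p - 1, by omega⟩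
          have h1 := D.comp_d_π (p := p) (q := q') (n := m + q) (by omega)
            (y ≫ D.ι m q (m + q) rfl) fun q' h' => by
              rw [Category.assoc, D.ι_π_ne _ _ _ _ _ _ _ (by omega), comp_zero]
          rw [← Category.assoc _ (D.π _ _ _ _), Category.assoc y (D.ι _ _ _ _) (D.π _ _ _ _),
            D.ι_π_ne _ _ _ _ _ _ _ (by omega), comp_zero, zero_comp, Category.assoc] at h1
          rw [hz _ _ _ (by omega), comp_zero, h1, sub_zero]) (fun p q' hpq => by
        rw [Preadditive.sub_comp, Category.assoc _ (T.d _ _) (T.d _ _), T.d_comp_d, comp_zero,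
          sub_zero, Category.assoc π₁, Category.assoc π₁, hd, comp_zero])
    refine ⟨A₂, π₂ ≫ π₁, inferInstance, x, t + π₂ ≫ y ≫ D.ι m q (m + q) rfl, ?_⟩
    rw [Preadditive.comp_sub, sub_eq_iff_eq_add] at hx
    rw [Category.assoc, hx, Preadditive.add_comp]
    simp only [Category.assoc]
    exact add_assoc (_ : _ ⟶ _) _ _

lemma IsAugmentation.exists_lift (h : D.IsAugmentation α e) (hD : D.RowsExact) (n : ℕ)
    {A : M} (z : A ⟶ T.X n)
    (hd : ∀ p q hpq, (z ≫ T.d n (n + 1)) ≫ D.π (p + 1) q (n + 1) hpq = 0) :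
    ∃ (A' : M) (π : A' ⟶ A) (_ : Epi π) (x : A' ⟶ E.X n)
      (y : A' ⟶ T.X ((ComplexShape.up ℕ).prev n)),
      π ≫ z = x ≫ α.f n + y ≫ T.d ((ComplexShape.up ℕ).prev n) n := by
  obtain _ | n := n
  -- In degree `0` the predecessor `prev 0` is `0` itself and the differential between them is zero,
  -- so `y = 0` is a harmless default.
  · obtain ⟨A', π, hπ, x, hx⟩ := h.lift z (fun p q hpq => by omega) hd
    exact ⟨A', π, hπ, x, 0, by rw [hx, zero_comp, add_zero]⟩
  · have hn : (ComplexShape.up ℕ).prev (n + 1) = n := by simp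
    rw [hn]
    exact h.lift_of_support hD n (n + 1) z (fun p q hpq _ => by omega) hd

/-- An augmentation of a double complex with exact rows is a quasi-isomorphism to the total
complex. -/
theorem IsAugmentation.isIso_homologyMap (h : D.IsAugmentation α e) (hD : D.RowsExact) (n : ℕ) :
    IsIso (HomologicalComplex.homologyMap α n) := by
  have hn : (ComplexShape.up ℕ).next n = n + 1 := by simp
  have : Mono (HomologicalComplex.homologyMap α n) := by
    rw [HomologicalComplex.mono_homologyMap_iff_up_to_refinements α _ n (n + 1) rfl hn]
    intro A x hx y hy
    obtain _ | n := n
    · refine ⟨A, 𝟙 A, inferInstance, 0, ?_⟩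
      rw [T.shape _ _ (by simp), comp_zero] at hy
      have := h.mono_f 0
      rw [zero_comp, Category.id_comp]
      exact Limits.zero_of_comp_mono _ hy
    · have hp : (ComplexShape.up ℕ).prev (n + 1) = n := by simp
      revert y
      rw [hp]
      intro y hy
      -- The coboundary of `y` is the image of `x`, hence lies in column `0`. So `y` agrees with an
      -- element of `E` up to a coboundary, and the coboundary of that element is `x`, as `α` is
      -- mono.
      obtain ⟨A', π, hπ, x', t, hx'⟩ := h.exists_lift hD n y fun p q hpq => by
        rw [← hy, h.eq, Category.assoc, Category.assoc, D.ι_π_ne _ _ _ _ _ _ _ (by omega),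
          comp_zero, comp_zero]
      refine ⟨A', π, hπ, x', ?_⟩
      have := h.mono_f (n + 1)
      rw [← cancel_mono (α.f (n + 1)), Category.assoc, hy, ← Category.assoc, hx',
        Preadditive.add_comp, Category.assoc, Category.assoc, T.d_comp_d, comp_zero, add_zero,
        α.comm, Category.assoc]
  have : Epi (HomologicalComplex.homologyMap α n) := by
    rw [HomologicalComplex.epi_homologyMap_iff_up_to_refinements α _ n (n + 1) rfl hn]
    intro A y hy
    obtain ⟨A', π, hπ, x, t, hx⟩ := h.exists_lift hD n y fun p q hpq => by rw [hy, zero_comp]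
    refine ⟨A', π, hπ, x, ?_, t, hx⟩
    have := h.mono_f (n + 1)
    have h1 := congrArg (· ≫ T.d n (n + 1)) hx
    simp only [Preadditive.add_comp, Category.assoc, T.d_comp_d, comp_zero, add_zero, hy,
      α.comm] at h1
    rw [← cancel_mono (α.f (n + 1)), zero_comp, Category.assoc, ← h1]
  exact isIso_of_mono_of_epi _

end Bigrading

end Bigraded

/-! ### Products of skyscraper sheaves and their universal property. -/

section Coinduced

variable {M : Type w} [Category.{u} M]
variable {V : Type u} {K : AbstractSimplicialComplex V}

/-- Morphisms to the sections of a sheaf are determined by their germs. -/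
lemma hom_sections_ext (F : (space K).Sheaf M) {U : Opens (space K)} {A : M}
    {x y : A ⟶ F.presheaf.obj (op U)}
    (h : ∀ σ (hσ : σ ∈ U), x ≫ F.presheaf.map (homOfLE (star_le_of_mem hσ)).op =
      y ≫ F.presheaf.map (homOfLE (star_le_of_mem hσ)).op) : x = y := by
  refine F.2.hom_ext_ofArrows (fun σ : {σ // σ ∈ U} => homOfLE (star_le_of_mem σ.2)) ?_
    fun σ => h σ.1 σ.2
  exact fun σ hσ => ⟨star σ, homOfLE (star_le_of_mem hσ),
    ⟨star σ, 𝟙 _, _, ⟨(⟨σ, hσ⟩ : {σ // σ ∈ U})⟩, rfl⟩, le_refl σ⟩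

/-- A morphism of sheaves is determined by its values at the stars. -/
lemma sheaf_hom_ext {F G : (space K).Sheaf M} {φ ψ : F ⟶ G}
    (h : ∀ σ, (sectionsAt M σ).map φ = (sectionsAt M σ).map ψ) : φ = ψ := by
  refine (TopCat.Sheaf.forget M (space K)).map_injective ?_
  ext U
  refine hom_sections_ext G fun σ hσ => ?_
  have e (χ : F ⟶ G) := ((TopCat.Sheaf.forget M (space K)).map χ).naturality
    (homOfLE (star_le_of_mem hσ)).op
  refine (e φ).symm.trans (Eq.trans ?_ (e ψ))
  exact congrArg (F.presheaf.map (homOfLE (star_le_of_mem hσ)).op ≫ ·) (h σ)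

lemma mono_of_mono_sectionsAt {F G : (space K).Sheaf M} (φ : F ⟶ G)
    (h : ∀ σ, Mono ((sectionsAt M σ).map φ)) : Mono φ where
  right_cancellation a b hab := sheaf_hom_ext fun σ => by
    rw [← cancel_mono ((sectionsAt M σ).map φ), ← Functor.map_comp, hab, Functor.map_comp]

variable [HasProducts.{u} M]

/-- The presheaf `U ↦ ∏ A_i`, the product over all `i` with `j i ∈ U`. -/
def coinducedPresheaf {J : Type u} (j : J → Simplices K) (A : J → M) :
    TopCat.Presheaf M (space K) where
  obj U := ∏ᶜ fun i : {i // j i ∈ U.unop} => A i.1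
  map g := Pi.lift fun i => Pi.π (fun i : {i // j i ∈ _} => A i.1) ⟨i.1, g.unop.le i.2⟩
  map_id U := Pi.hom_ext _ _ fun i => by
    rw [Pi.lift_π, Category.id_comp]
  map_comp f g := Pi.hom_ext _ _ fun i => by
    rw [Pi.lift_π, Category.assoc, Pi.lift_π, Pi.lift_π]

variable {J : Type u} (j : J → Simplices K) (A : J → M)

/-- The projection of `∏ A_i`, the product over all `i` with `j i ∈ U`. -/
def coinducedπ {U : Opens (space K)} (i : J) (hi : j i ∈ U) :
    (coinducedPresheaf j A).obj (op U) ⟶ A i :=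
  Pi.π (fun i : {i // j i ∈ U} => A i.1) ⟨i, hi⟩

/-- Lifts to the sections of the coinduced sheaf. -/
def coinducedLift {U : Opens (space K)} {S : M} (a : ∀ i, j i ∈ U → (S ⟶ A i)) :
    S ⟶ (coinducedPresheaf j A).obj (op U) :=
  Pi.lift fun i => a i.1 i.2

lemma coinducedLift_π {U : Opens (space K)} {S : M} (a : ∀ i, j i ∈ U → (S ⟶ A i)) (i : J)
    (hi : j i ∈ U) : coinducedLift j A a ≫ coinducedπ j A i hi = a i hi :=
  Pi.lift_π _ _

lemma coinduced_map_π {U U' : Opens (space K)} (h : U' ≤ U) (i : J) (hi : j i ∈ U') :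
    (coinducedPresheaf j A).map (homOfLE h).op ≫ coinducedπ j A i hi =
      coinducedπ j A i (h hi) :=
  Pi.lift_π _ _

variable {j A} in
lemma coinduced_hom_ext {U : Opens (space K)} {S : M}
    {x y : S ⟶ (coinducedPresheaf j A).obj (op U)}
    (h : ∀ i hi, x ≫ coinducedπ j A i hi = y ≫ coinducedπ j A i hi) : x = y :=
  Pi.hom_ext _ _ fun i => h i.1 i.2

/-- To glue, take the factor at `i` from any member of the cover that contains `j i`. Comparison on
the intersection of two such members (`key`) shows that the choice does not matter. -/
lemma coinducedPresheaf_isSheaf : (coinducedPresheaf j A).IsSheaf := by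
  intro S U R hR x hx
  choose U' g hg hU' using hR
  have key {U₁ U₂ : Opens (space K)} (g₁ : U₁ ⟶ U) (g₂ : U₂ ⟶ U) (h₁ : R g₁) (h₂ : R g₂) (i : J)
      (hi₁ : j i ∈ U₁) (hi₂ : j i ∈ U₂) :
      (show S ⟶ (coinducedPresheaf j A).obj (op U₁) from x g₁ h₁) ≫ coinducedπ j A i hi₁ =
      (show S ⟶ (coinducedPresheaf j A).obj (op U₂) from x g₂ h₂) ≫ coinducedπ j A i hi₂ := by
    have h := hx (homOfLE (inf_le_left : U₁ ⊓ U₂ ≤ U₁)) (homOfLE (inf_le_right : U₁ ⊓ U₂ ≤ U₂)) h₁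
      h₂ rfl
    have h' := congrArg (fun y : S ⟶ (coinducedPresheaf j A).obj (op (U₁ ⊓ U₂)) =>
      y ≫ coinducedπ j A i ⟨hi₁, hi₂⟩) h
    refine Eq.trans ?_ (h'.trans ?_)
    · refine Eq.trans ?_ (Category.assoc _ _ _).symm
      exact congrArg (_ ≫ ·)
        (coinduced_map_π j A (inf_le_left : U₁ ⊓ U₂ ≤ U₁) i ⟨hi₁, hi₂⟩).symm
    · refine (Category.assoc _ _ _).trans ?_
      exact congrArg (_ ≫ ·) (coinduced_map_π j A (inf_le_right : U₁ ⊓ U₂ ≤ U₂) i ⟨hi₁, hi₂⟩)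
  refine ⟨coinducedLift j A fun i hi => (show S ⟶ (coinducedPresheaf j A).obj (op (U' _ hi)) from
    x (g _ hi) (hg _ hi)) ≫ coinducedπ j A i (hU' _ hi), ?_, ?_⟩
  · intro U₁ g₁ h₁
    refine coinduced_hom_ext fun i hi => ?_
    refine (Category.assoc _ _ _).trans ?_
    refine (congrArg (_ ≫ ·) (coinduced_map_π j A g₁.le i hi)).trans ?_
    refine (coinducedLift_π j A _ i _).trans ?_
    exact key _ _ _ _ _ _ _
  · intro y hy
    refine coinduced_hom_ext fun i hi => ?_
    refine Eq.trans ?_ (coinducedLift_π j A _ i hi).symm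
    have h := congrArg (fun z : S ⟶ (coinducedPresheaf j A).obj (op (U' _ hi)) =>
      z ≫ coinducedπ j A i (hU' _ hi)) (hy (g _ hi) (hg _ hi))
    refine Eq.trans ?_ h
    refine Eq.trans ?_ (Category.assoc _ _ _).symm
    exact congrArg (y ≫ ·) (coinduced_map_π j A (g _ hi).le i _).symm

/-- The sheaf `U ↦ ∏ A_i`, the product over all `i` with `j i ∈ U`. -/
def coinduced : (space K).Sheaf M := ⟨coinducedPresheaf j A, coinducedPresheaf_isSheaf j A⟩

/-- The projection of the sections of the coinduced sheaf over the star of `j i`. -/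
def coinducedEval (i : J) : (sectionsAt M (j i)).obj (coinduced j A) ⟶ A i :=
  coinducedπ j A (U := star (j i)) i (le_refl (j i))

variable {A} {F : (space K).Sheaf M}

/-- The morphism to the coinduced sheaf with given components. -/
def toCoinduced (a : ∀ i, (sectionsAt M (j i)).obj F ⟶ A i) : F ⟶ coinduced j A :=
  (TopCat.Sheaf.forget M (space K)).preimage
    { app U := coinducedLift j A (U := U.unop) fun i hi =>
        F.presheaf.map (homOfLE (star_le_of_mem hi)).op ≫ a i
      naturality U U' g := coinduced_hom_ext fun i hi => by
        refine (Category.assoc _ _ _).trans ?_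
        refine (congrArg (_ ≫ ·) (coinducedLift_π j A _ i hi)).trans ?_
        refine Eq.trans ?_ (Category.assoc _ _ _).symm
        refine Eq.trans ?_ (congrArg (_ ≫ ·) (coinduced_map_π j A g.unop.le i hi)).symm
        refine Eq.trans ?_ (coinducedLift_π j A _ i _).symm
        refine Eq.trans (Category.assoc (F.presheaf.map g) _ (a i)).symm ?_
        exact congrArg (· ≫ a i) (F.presheaf.map_comp _ _).symm }

lemma toCoinduced_app_π (a : ∀ i, (sectionsAt M (j i)).obj F ⟶ A i) {U : Opens (space K)} (i : J)
    (hi : j i ∈ U) :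
    ((TopCat.Sheaf.forget M (space K)).map (toCoinduced j a)).app (op U) ≫ coinducedπ j A i hi =
      F.presheaf.map (homOfLE (star_le_of_mem hi)).op ≫ a i := by
  rw [toCoinduced, Functor.map_preimage]
  exact coinducedLift_π j A (U := U)
    (fun i hi => F.presheaf.map (homOfLE (star_le_of_mem hi)).op ≫ a i) i hi

lemma toCoinduced_eval (a : ∀ i, (sectionsAt M (j i)).obj F ⟶ A i) (i : J) :
    (sectionsAt M (j i)).map (toCoinduced j a) ≫ coinducedEval j A i = a i := by
  refine (toCoinduced_app_π j a (U := star (j i)) i (le_refl (j i))).trans ?_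
  refine (congrArg (· ≫ a i) (F.presheaf.map_id _)).trans ?_
  exact Category.id_comp _

variable {j} in
lemma hom_coinduced_app_π (φ : F ⟶ coinduced j A) {U : Opens (space K)} (i : J) (hi : j i ∈ U) :
    ((TopCat.Sheaf.forget M (space K)).map φ).app (op U) ≫ coinducedπ j A i hi =
      F.presheaf.map (homOfLE (star_le_of_mem hi)).op ≫
        (sectionsAt M (j i)).map φ ≫ coinducedEval j A i := by
  have h := ((TopCat.Sheaf.forget M (space K)).map φ).naturality
    (homOfLE (star_le_of_mem hi)).op
  refine Eq.trans ?_ ((congrArg (· ≫ coinducedEval j A i) h).symm.trans (Category.assoc _ _ _))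
  refine Eq.trans ?_ (Category.assoc _ _ _).symm
  exact congrArg (_ ≫ ·) (coinduced_map_π j A (star_le_of_mem hi) i (le_refl (j i))).symm

variable {j} in
lemma toCoinduced_ext {φ ψ : F ⟶ coinduced j A}
    (h : ∀ i, (sectionsAt M (j i)).map φ ≫ coinducedEval j A i =
      (sectionsAt M (j i)).map ψ ≫ coinducedEval j A i) : φ = ψ := by
  refine (TopCat.Sheaf.forget M (space K)).map_injective ?_
  ext U
  refine coinduced_hom_ext (U := U) fun i hi => ?_
  exact (hom_coinduced_app_π φ i hi).trans ((congrArg (_ ≫ ·) (h i)).trans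
    (hom_coinduced_app_π ψ i hi).symm)

end Coinduced

/-! ### Exactness of sections over a star. -/

section Exactness

variable {M : Type w} [Category.{u} M] {V : Type u} {K : AbstractSimplicialComplex V}

/-- The functor of sections over a star is left adjoint to the skyscraper sheaf functor. -/
lemma sectionsAt_isLeftAdjoint [HasProducts.{u} M] (σ : Simplices K) :
    (sectionsAt M σ).IsLeftAdjoint :=
  ⟨_, ⟨Adjunction.adjunctionOfEquivRight (F := sectionsAt M σ)
    (G_obj := fun A => coinduced (fun _ : PUnit => σ) fun _ => A)
    (fun F A =>
      { toFun a := toCoinduced (fun _ : PUnit => σ) (A := fun _ => A) fun _ => a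
        invFun φ := (sectionsAt M σ).map φ ≫ coinducedEval (fun _ : PUnit => σ) (fun _ => A) ⟨⟩
        left_inv a := toCoinduced_eval (fun _ : PUnit => σ) (A := fun _ => A) (fun _ => a) ⟨⟩
        right_inv φ := toCoinduced_ext fun i => toCoinduced_eval _ _ i })
    (fun F F' A g a => toCoinduced_ext fun i => by
      refine (toCoinduced_eval (fun _ : PUnit => σ) (A := fun _ => A) _ i).trans ?_
      rw [Functor.map_comp, Category.assoc]
      exact congrArg (_ ≫ ·)
        (toCoinduced_eval (fun _ : PUnit => σ) (A := fun _ => A) (fun _ => a) i).symm)⟩⟩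

variable [Abelian M] [IsGrothendieckAbelian.{u} M]

instance (σ : Simplices K) : (sectionsAt M σ).IsLeftAdjoint := sectionsAt_isLeftAdjoint σ

/-- Limits of sheaves are computed on sections. Together with the right adjoint this makes
`sectionsAt M σ` exact. -/
instance (σ : Simplices K) : PreservesFiniteLimits (sectionsAt M σ) :=
  inferInstanceAs (PreservesFiniteLimits (sheafToPresheaf _ _ ⋙ (evaluation _ M).obj _))

end Exactness

/-! ### Stalks and exactness of the inverse image. -/

section Pullback

variable {V W : Type u} [LinearOrder V] [LinearOrder W]
variable {X : AbstractSimplicialComplex V} {Y : AbstractSimplicialComplex W}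
variable {M : Type w} [Category.{u} M] [Abelian M] [IsGrothendieckAbelian.{u} M]
variable (f : SimplicialMap X Y)

/-- The Yoneda lemma for the functors corepresented by `A` and `B`. -/
lemma isIso_of_bijective_precomp {M : Type*} [Category* M] {A B : M} (s : A ⟶ B)
    (hs : ∀ C : M, Function.Bijective fun t : B ⟶ C => s ≫ t) : IsIso s := by
  obtain ⟨r, hr⟩ := (hs A).2 (𝟙 A)
  refine ⟨r, hr, (hs B).1 ?_⟩
  dsimp only at hr ⊢
  rw [← Category.assoc, hr, Category.id_comp, Category.comp_id]

/-- The morphism `F ⟶ f_* G` that corresponds to `φ : f^* F ⟶ G`. -/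
def adjunct {F : (space Y).Sheaf M} {G : (space X).Sheaf M} (φ : (pullback M f).obj F ⟶ G) :
    F ⟶ (TopCat.Sheaf.pushforward M f.onSpace).obj G :=
  (pullbackAdjunction M f).homEquiv F G φ

lemma adjunct_app {F : (space Y).Sheaf M} {G : (space X).Sheaf M} (φ : (pullback M f).obj F ⟶ G)
    (σ : Simplices X) :
    (sectionsAt M (f.onSimplices σ)).map (adjunct f φ) ≫
        G.presheaf.map (homOfLE (show star σ ≤ (Opens.map f.onSpace).obj (star (f.onSimplices σ))
          from fun _ h => f.monotone h)).op =
      stalkMap f F σ ≫ (sectionsAt M σ).map φ := by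
  have h1 : adjunct f φ = (pullbackAdjunction M f).unit.app F ≫
      (TopCat.Sheaf.pushforward M f.onSpace).map φ :=
    (pullbackAdjunction M f).homEquiv_unit F G φ
  rw [h1]
  have h2 := ((TopCat.Sheaf.forget M (space X)).map φ).naturality
    (homOfLE (show star σ ≤ (Opens.map f.onSpace).obj (star (f.onSimplices σ))
          from fun _ h => f.monotone h)).op
  refine (congrArg (· ≫ _) (Functor.map_comp _ _ _)).trans ?_
  refine (Category.assoc _ _ _).trans ?_
  refine (congrArg (_ ≫ ·) h2.symm).trans ?_
  exact (Category.assoc _ _ _).symm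

/-- The canonical map `F(f(σ)) ⟶ (f^*F)(σ)` is an isomorphism: both objects represent the functor
of morphisms from `F` to the skyscraper sheaf at `f(σ)`, which is the direct image of the one at
`σ`. -/
theorem isIso_stalkMap (F : (space Y).Sheaf M) (σ : Simplices X) : IsIso (stalkMap f F σ) := by
  refine isIso_of_bijective_precomp _ fun A => ?_
  let E : (space X).Sheaf M := coinduced (fun _ : PUnit.{u + 1} => σ) fun _ => A
  let E' : (space Y).Sheaf M := coinduced (fun _ : PUnit.{u + 1} => f.onSimplices σ) fun _ => A
  let e : (sectionsAt M σ).obj E ⟶ A := coinducedEval (fun _ : PUnit => σ) (fun _ => A) ⟨⟩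
  let e' : (sectionsAt M (f.onSimplices σ)).obj E' ⟶ A :=
    coinducedEval (fun _ : PUnit => f.onSimplices σ) (fun _ => A) ⟨⟩
  -- The direct image of `E` is `E'` by definition, since `σ ∈ f⁻¹(U)` and `f(σ) ∈ U` are the same
  -- condition. Thus precomposition with `stalkMap` is the adjunction bijection `Hom(f^*F, E) ≃
  -- Hom(F, E')`, read off on stalks.
  have he (φ : (pullback M f).obj F ⟶ E) :
      (sectionsAt M (f.onSimplices σ)).map (show F ⟶ E' from adjunct f φ) ≫ e' =
        stalkMap f F σ ≫ (sectionsAt M σ).map φ ≫ e := by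
    rw [← Category.assoc (stalkMap f F σ)]
    refine Eq.trans ?_ (congrArg (· ≫ e) (adjunct_app f φ σ))
    refine Eq.trans ?_ (Category.assoc _ _ _).symm
    refine congrArg (_ ≫ ·) ?_
    exact (coinduced_map_π (fun _ : PUnit => σ) (fun _ => A)
      (show star σ ≤ (Opens.map f.onSpace).obj (star (f.onSimplices σ)) from
        fun _ h => f.monotone h) ⟨⟩ (le_refl σ)).symm
  constructor
  · intro a b hab
    let φ (t : (sectionsAt M σ).obj ((pullback M f).obj F) ⟶ A) : (pullback M f).obj F ⟶ E :=
      toCoinduced (fun _ : PUnit => σ) (A := fun _ => A) fun _ => t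
    have hφ (t) : (sectionsAt M σ).map (φ t) ≫ e = t :=
      toCoinduced_eval (fun _ : PUnit => σ) (A := fun _ => A) (fun _ => t) ⟨⟩
    have h1 : (show F ⟶ E' from adjunct f (φ a)) = adjunct f (φ b) := by
      refine toCoinduced_ext fun i => ?_
      refine (he (φ a)).trans (Eq.trans ?_ (he (φ b)).symm)
      rw [hφ, hφ]
      exact hab
    have h2 : φ a = φ b := ((pullbackAdjunction M f).homEquiv F E).injective h1
    rw [← hφ a, ← hφ b, h2]
  · intro t
    let ψ : F ⟶ E' :=
      toCoinduced (fun _ : PUnit => f.onSimplices σ) (A := fun _ => A) fun _ => t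
    obtain ⟨φ, hφ⟩ := ((pullbackAdjunction M f).homEquiv F E).surjective ψ
    refine ⟨(sectionsAt M σ).map φ ≫ e, (he φ).symm.trans ?_⟩
    have : (show F ⟶ E' from adjunct f φ) = ψ := hφ
    rw [this]
    exact toCoinduced_eval (fun _ : PUnit => f.onSimplices σ) (A := fun _ => A) (fun _ => t) ⟨⟩

lemma stalkMap_naturality {F G : (space Y).Sheaf M} (φ : F ⟶ G) (σ : Simplices X) :
    (sectionsAt M (f.onSimplices σ)).map φ ≫ stalkMap f G σ =
      stalkMap f F σ ≫ (sectionsAt M σ).map ((pullback M f).map φ) :=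
  sectionMap_naturality f φ _

/-- Monomorphisms can be tested on stars, where `f^*φ` is isomorphic to `φ` at `f(σ)` by
`isIso_stalkMap`. -/
instance : (pullback M f).PreservesMonomorphisms where
  preserves {F G} φ hφ := mono_of_mono_sectionsAt _ fun σ => by
    have := isIso_stalkMap f F σ
    have := isIso_stalkMap f G σ
    have h : (sectionsAt M σ).map ((pullback M f).map φ) =
        inv (stalkMap f F σ) ≫ (sectionsAt M (f.onSimplices σ)).map φ ≫ stalkMap f G σ := by
      rw [IsIso.eq_inv_comp, stalkMap_naturality]
    rw [h]
    infer_instance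

/-- A left adjoint preserves cokernels; with monomorphisms preserved too, it is exact. -/
instance : (pullback M f).PreservesHomology :=
  (pullback M f).preservesHomology_of_preservesMonos_and_cokernels

end Pullback

/-! ### Comparison of resolutions along an exact functor. -/

section Lift

variable {C D : Type*} [Category* C] [Abelian C] [Category* D] [Abelian D]

/-- The image of an injective resolution under an exact functor maps to every injective resolution
of the image. -/
lemma exists_lift_map_injectiveResolution (L : C ⥤ D) [L.Additive] [L.PreservesHomology] {Z : C}
    (I : InjectiveResolution Z) (J : InjectiveResolution (L.obj Z)) :
    ∃ g : (L.mapHomologicalComplex _).obj I.cocomplex ⟶ J.cocomplex,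
      L.map (I.ι.f 0) ≫ g.f 0 = J.ι.f 0 := by
  let i : Z ⟶ I.cocomplex.X 0 := I.ι.f 0
  let j : L.obj Z ⟶ J.cocomplex.X 0 := J.ι.f 0
  have : Mono i := inferInstanceAs (Mono (I.ι.f 0))
  have h₀ := I.exact₀.map L
  have hs (n : ℕ) := (I.exact_succ n).map L
  let g₀ : L.obj (I.cocomplex.X 0) ⟶ J.cocomplex.X 0 :=
    Injective.factorThru (j) (L.map i)
  have hg₀ : L.map i ≫ g₀ = j := Injective.comp_factorThru _ _
  let g₁ : L.obj (I.cocomplex.X 1) ⟶ J.cocomplex.X 1 :=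
    h₀.descToInjective (g₀ ≫ J.cocomplex.d 0 1) (by
    refine (Category.assoc _ _ _).symm.trans ((congrArg (· ≫ _) hg₀).trans ?_)
    exact J.ι_f_zero_comp_complex_d)
  have hg₁ : L.map (I.cocomplex.d 0 1) ≫ g₁ = g₀ ≫ J.cocomplex.d 0 1 :=
    h₀.comp_descToInjective _ _
  -- The source need only be exact and the target injective: at each step the next component
  -- descends along the exact sequence `L(I^n) ⟶ L(I^(n+1)) ⟶ L(I^(n+2))`.
  refine ⟨CochainComplex.mkHom _ _ g₀ g₁ hg₁.symm fun n ⟨g, g', w⟩ =>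
    ⟨(hs n).descToInjective (g' ≫ J.cocomplex.d (n + 1) (n + 2)) ?_, ?_⟩, ?_⟩
  · refine (Category.assoc _ _ _).symm.trans ((congrArg (· ≫ _) w.symm).trans ?_)
    rw [Category.assoc, J.cocomplex.d_comp_d]
    exact comp_zero
  · exact ((hs n).comp_descToInjective _ _).symm
  · exact hg₀

end Lift

/-! ### Existence of the data that define `H^k(f)`. -/

section InducedMap

variable {V W : Type u} [LinearOrder V] [LinearOrder W]
variable {X : AbstractSimplicialComplex V} {Y : AbstractSimplicialComplex W}
variable {M : Type w} [Category.{u} M] [Abelian M] [IsGrothendieckAbelian.{u} M]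

lemma nonempty_inducedMapData (f : SimplicialMap X Y) (F : (space Y).Sheaf M) :
    Nonempty (InducedMapData f F) := by
  let I := injectiveResolution F
  let J := injectiveResolution ((pullback M f).obj F)
  obtain ⟨g, hg⟩ := exists_lift_map_injectiveResolution (pullback M f) I J
  exact ⟨⟨I, J, g, hg⟩⟩

end InducedMap

/-! ### Sign identities for simplicial maps. -/

section Signs

variable {V W : Type u} [LinearOrder V] [LinearOrder W]
variable {X : AbstractSimplicialComplex V} {Y : AbstractSimplicialComplex W}
variable (f : SimplicialMap X Y)

/-- The inversions that involve `v` are the `x > v` with `f x < f v` and the `x < v` with `f x > f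
v`. Adding all `x` with `f x < f v` counts the first kind twice and completes the second to all `x <
v` with `f x ≠ f v`. Injectivity is not assumed, so degenerate simplices are covered as well. -/
lemma mapSign_mul_erase {s : Finset V} {v : V} (hv : v ∈ s) :
    mapSign f s * (-1) ^ (s.filter fun x => f.toFun x < f.toFun v).card =
      mapSign f (s.erase v) *
        (-1) ^ (s.filter fun x => x < v ∧ f.toFun x ≠ f.toFun v).card := by
  have h : ((s ×ˢ s).filter fun a => a.1 < a.2 ∧ f.toFun a.2 < f.toFun a.1).card +
        (s.filter fun x => f.toFun x < f.toFun v).card =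
      (((s.erase v) ×ˢ (s.erase v)).filter
          fun a => a.1 < a.2 ∧ f.toFun a.2 < f.toFun a.1).card +
        (s.filter fun x => x < v ∧ f.toFun x ≠ f.toFun v).card +
        2 * (s.filter fun x => v < x ∧ f.toFun x < f.toFun v).card := by
    simp only [Finset.card_filter, Finset.sum_product]
    have hi (g : V → ℕ) : ∑ x ∈ s, g x = g v + ∑ x ∈ s.erase v, g x :=
      (Finset.add_sum_erase s g hv).symm
    simp only [hi, lt_irrefl, if_false, ne_eq, not_true, and_false, zero_add,
      Finset.sum_add_distrib, Finset.mul_sum]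
    have : ∀ x ∈ s.erase v,
        (if v < x ∧ f.toFun x < f.toFun v then 1 else 0) +
          (if x < v ∧ f.toFun v < f.toFun x then 1 else 0) +
          (if f.toFun x < f.toFun v then 1 else 0) =
        (if x < v ∧ ¬ f.toFun x = f.toFun v then 1 else 0) +
          2 * (if v < x ∧ f.toFun x < f.toFun v then 1 else 0) := by
      intro x hx
      have hx := Finset.ne_of_mem_erase hx
      rcases lt_or_gt_of_ne hx with h | h <;>
        rcases lt_trichotomy (f.toFun x) (f.toFun v) with h' | h' | h' <;>
        first
          | simp [h, h', h.not_gt, h'.not_gt, h'.ne, h'.ne']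
          | simp [h, h', h.not_gt]
    have := Finset.sum_congr rfl this
    simp only [Finset.sum_add_distrib] at this
    linarith
  rw [mapSign, mapSign, ← pow_add, ← pow_add, h, pow_add _ _ (2 * _), pow_mul]
  simp

lemma mapSign_mul_posSign {s : Finset V} (hs : Set.InjOn f.toFun s) {v : V} (hv : v ∈ s) :
    mapSign f s * posSign (s.image f.toFun) (f.toFun v) =
      posSign s v * mapSign f (s.erase v) := by
  have h := mapSign_mul_erase f hv
  have h1 : ((s.image f.toFun).filter (· < f.toFun v)).card =
      (s.filter fun x => f.toFun x < f.toFun v).card := by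
    rw [Finset.filter_image, Finset.card_image_of_injOn]
    exact hs.mono fun x hx => (Finset.mem_filter.1 hx).1
  have h2 : (s.filter fun x => x < v ∧ f.toFun x ≠ f.toFun v) = s.filter (· < v) :=
    Finset.filter_congr fun x hx => ⟨And.left, fun h => ⟨h, fun e => h.ne (hs hx hv e)⟩⟩
  rw [posSign, posSign, h1, h, h2, mul_comm]

/-- Apply `mapSign_mul_erase` at `u` and at `v`. The left-hand sides agree because `f u = f v`. For
`u < v` the vertex `u` is missing from the count of predecessors of `v`, which produces the opposite
sign. -/
lemma posSign_mul_mapSign_add {s : Finset V} {u v : V} (hu : u ∈ s) (hv : v ∈ s) (huv : u ≠ v)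
    (hf : f.toFun u = f.toFun v) (hs : Set.InjOn f.toFun (s.erase u))
    (hs' : Set.InjOn f.toFun (s.erase v)) :
    posSign s u * mapSign f (s.erase u) + posSign s v * mapSign f (s.erase v) = 0 := by
  wlog hlt : u < v generalizing u v
  · rw [add_comm]
    exact this hv hu huv.symm hf.symm hs' hs (lt_of_le_of_ne (not_lt.1 hlt) huv.symm)
  have h1 := mapSign_mul_erase f hu
  have h2 := mapSign_mul_erase f hv
  have h3 : (s.filter fun x => x < u ∧ f.toFun x ≠ f.toFun u) = s.filter (· < u) :=
    Finset.filter_congr fun x hx => ⟨And.left, fun h => ⟨h, fun e => h.ne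
      (hs' (Finset.mem_erase.2 ⟨(h.trans hlt).ne, hx⟩) (Finset.mem_erase.2 ⟨huv, hu⟩) e)⟩⟩
  have h4 : s.filter (· < v) =
      insert u (s.filter fun x => x < v ∧ f.toFun x ≠ f.toFun v) := by
    ext x
    simp only [Finset.mem_filter, Finset.mem_insert]
    constructor
    · rintro ⟨hx, hxv⟩
      refine or_iff_not_imp_left.2 fun hxu => ⟨hx, hxv, fun e => hxv.ne ?_⟩
      exact hs (Finset.mem_erase.2 ⟨hxu, hx⟩) (Finset.mem_erase.2 ⟨huv.symm, hv⟩) e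
    · rintro (rfl | ⟨hx, hxv, -⟩)
      · exact ⟨hu, hlt⟩
      · exact ⟨hx, hxv⟩
  have h5 : (s.filter (· < v)).card =
      (s.filter fun x => x < v ∧ f.toFun x ≠ f.toFun v).card + 1 := by
    rw [h4, Finset.card_insert_of_notMem (by simp [hf])]
  rw [h3, hf] at h1
  rw [posSign, posSign, h5, pow_succ]
  linear_combination h2 - h1

end Signs

/-! ### The cellular cochain map of a simplicial map. -/

section CellMap

variable {V W : Type u} [LinearOrder V] [LinearOrder W]
variable {X : AbstractSimplicialComplex V} {Y : AbstractSimplicialComplex W}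
variable {M : Type w} [Category.{u} M] [Abelian M] [IsGrothendieckAbelian.{u} M]
variable (f : SimplicialMap X Y) (F : (space Y).Sheaf M)

lemma cellMap_proj {k : ℕ} (σ : KSimplex X k) (h : (f.onSimplices σ.simplex).verts.card = k + 1) :
    cellMap f F k ≫ proj _ σ =
      mapSign f σ.verts • (proj F ⟨f.onSimplices σ.simplex, h⟩ ≫ stalkMap f F σ.simplex) :=
  (liftCochains_proj _ _ σ).trans (dif_pos h)

lemma cellMap_proj_eq_zero {k : ℕ} (σ : KSimplex X k)
    (h : (f.onSimplices σ.simplex).verts.card ≠ k + 1) : cellMap f F k ≫ proj _ σ = 0 :=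
  (liftCochains_proj _ _ σ).trans (dif_neg h)

lemma presheaf_map_comp_eq {C : Type*} [Category* C] {A : TopCat.{u}} (P : TopCat.Presheaf C A)
    {U₁ U₂ U₂' U₃ : Opens A} (a : U₂ ≤ U₁) (b : U₃ ≤ U₂) (c : U₂' ≤ U₁) (d : U₃ ≤ U₂') :
    P.map (homOfLE a).op ≫ P.map (homOfLE b).op = P.map (homOfLE c).op ≫ P.map (homOfLE d).op :=
  (P.map_comp _ _).symm.trans (P.map_comp (homOfLE c).op (homOfLE d).op)

lemma stalkMap_res {σ τ : Simplices X} (h : σ ≤ τ) :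
    stalkMap f F σ ≫ res ((pullback M f).obj F) h = res F (f.monotone h) ≫ stalkMap f F τ := by
  have h1 := ((TopCat.Sheaf.forget M (space Y)).map
    ((pullbackAdjunction M f).unit.app F)).naturality (homOfLE (star_le_star (f.monotone h))).op
  refine Eq.trans ?_ ((congrArg (· ≫ ((pullback M f).obj F).presheaf.map (homOfLE
    (show star τ ≤ (Opens.map f.onSpace).obj (star (f.onSimplices τ)) from
      fun _ h => f.monotone h)).op) h1).symm.trans (Category.assoc _ _ _))
  refine (Category.assoc _ _ _).trans (Eq.trans ?_ (Category.assoc _ _ _).symm)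
  refine congrArg (_ ≫ ·) ?_
  exact presheaf_map_comp_eq _ (fun _ h => f.monotone h) (star_le_star h)
    (fun _ h' => (f.monotone h).trans h') (fun _ h => f.monotone h)

/-- The image simplex enters as a free `ρ` with an equation, so that terms from different faces with
the same image take the same form. -/
lemma cellMap_res {k : ℕ} (σ : KSimplex X k) {τ : Simplices X} (hτ : σ.simplex ≤ τ)
    (ρ : KSimplex Y k) (hρ : f.onSimplices σ.simplex = ρ.simplex)
    (hρτ : ρ.simplex ≤ f.onSimplices τ) :
    cellMap f F k ≫ proj _ σ ≫ res _ hτ =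
      mapSign f σ.verts • ((proj F ρ ≫ res F hρτ) ≫ stalkMap f F τ) := by
  obtain ⟨ρ, hc⟩ := ρ
  obtain rfl : f.onSimplices σ.simplex = ρ := hρ
  rw [← Category.assoc, cellMap_proj f F σ hc, Preadditive.zsmul_comp, Category.assoc,
    stalkMap_res, Category.assoc]

lemma cellMap_coboundary_proj {k : ℕ} (τ : KSimplex X (k + 1)) :
    (cellMap f F k ≫ coboundary ((pullback M f).obj F) k) ≫ proj _ τ =
      ∑ v : τ.verts, posSign τ.verts v.1 •
        (cellMap f F k ≫ proj _ (face τ v) ≫ res _ (face_le τ v)) := by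
  rw [Category.assoc, coboundary_proj, Preadditive.comp_sum]
  exact Finset.sum_congr rfl fun v _ => Preadditive.comp_zsmul _ _ _

lemma coboundary_cellMap_proj {k : ℕ} (τ : KSimplex X (k + 1)) :
    (coboundary F k ≫ cellMap f F (k + 1)) ≫ proj _ τ =
      (cellMap f F k ≫ coboundary ((pullback M f).obj F) k) ≫ proj _ τ := by
  rw [cellMap_coboundary_proj]
  have hle : (f.onSimplices τ.simplex).verts.card ≤ k + 1 + 1 :=
    Finset.card_image_le.trans_eq τ.card_eq
  have hface (v : τ.verts) : (τ.verts.erase v.1).card = k + 1 := (face τ v).card_eq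
  have hzero (v : τ.verts) (h : (f.onSimplices (face τ v).simplex).verts.card ≠ k + 1) :
      posSign τ.verts v.1 • (cellMap f F k ≫ proj _ (face τ v) ≫ res _ (face_le τ v)) = 0 := by
    rw [← Category.assoc, cellMap_proj_eq_zero f F _ h, zero_comp, smul_zero]
  -- If `f` is injective on `τ`, it matches the faces of `τ` with those of `f(τ)`, and the signs
  -- agree by `mapSign_mul_posSign`.
  obtain hc | hc := eq_or_ne (f.onSimplices τ.simplex).verts.card (k + 1 + 1)
  · have hinj : Set.InjOn f.toFun τ.verts := Finset.card_image_iff.1 (hc.trans τ.card_eq.symm)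
    rw [Category.assoc, cellMap_proj f F τ hc, Preadditive.comp_zsmul, ← Category.assoc,
      coboundary_proj, Preadditive.sum_comp, Finset.smul_sum]
    symm
    refine Fintype.sum_bijective (fun v : τ.verts =>
      (⟨f.toFun v.1, Finset.mem_image_of_mem _ v.2⟩ : (f.onSimplices τ.simplex).verts)) ?_ _ _ ?_
    · constructor
      · intro v v' h
        exact Subtype.ext (hinj v.2 v'.2 (congrArg Subtype.val h))
      · rintro ⟨w, hw⟩
        obtain ⟨v, hv, rfl⟩ := Finset.mem_image.1 hw
        exact ⟨⟨v, hv⟩, rfl⟩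
    · intro v
      rw [cellMap_res f F (face τ v) (face_le τ v) (face ⟨f.onSimplices τ.simplex, hc⟩
        ⟨f.toFun v.1, Finset.mem_image_of_mem _ v.2⟩) ?_ (face_le _ _), smul_smul,
        Preadditive.zsmul_comp, smul_smul]
      · exact congrArg (· • _) (mapSign_mul_posSign f hinj v.2).symm
      · refine Simplices.ext ?_
        change (τ.verts.erase v.1).image f.toFun = (τ.verts.image f.toFun).erase (f.toFun v.1)
        ext w
        simp only [Finset.mem_image, Finset.mem_erase]
        constructor
        · rintro ⟨x, ⟨hxv, hx⟩, rfl⟩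
          exact ⟨fun e => hxv (hinj hx v.2 e), x, hx, rfl⟩
        · rintro ⟨hw, x, hx, rfl⟩
          exact ⟨x, ⟨fun e => hw (congrArg f.toFun e), hx⟩, rfl⟩
  · rw [Category.assoc, cellMap_proj_eq_zero f F τ hc, comp_zero]
    symm
    have hlt : (τ.verts.image f.toFun).card < τ.verts.card := by
      rw [τ.card_eq]
      exact lt_of_le_of_ne hle hc
    obtain ⟨u, hu, v, hv, huv, hf⟩ : ∃ u ∈ τ.verts, ∃ v ∈ τ.verts, u ≠ v ∧ f.toFun u = f.toFun v :=
      Finset.exists_ne_map_eq_of_card_image_lt hlt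
    -- If exactly one vertex is lost, `u` and `v` are the only vertices identified. The faces
    -- opposite to them have image `f(τ)` and cancel; any other face contains both and is
    -- degenerate.
    obtain hc' | hc' := eq_or_ne (f.onSimplices τ.simplex).verts.card (k + 1)
    · have himg {a b : V} (hb : b ∈ τ.verts) (hab : a ≠ b) (h : f.toFun a = f.toFun b) :
          (τ.verts.erase a).image f.toFun = τ.verts.image f.toFun := by
        refine (Finset.image_subset_image (Finset.erase_subset _ _)).antisymm fun w hw => ?_
        obtain ⟨x, hx, rfl⟩ := Finset.mem_image.1 hw
        obtain rfl | hxa := eq_or_ne x a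
        · exact Finset.mem_image.2 ⟨b, Finset.mem_erase.2 ⟨hab.symm, hb⟩, h.symm⟩
        · exact Finset.mem_image_of_mem _ (Finset.mem_erase.2 ⟨hxa, hx⟩)
      have hu' := himg hv huv hf
      have hv' := himg hu huv.symm hf.symm
      have hinj (a : τ.verts) (h : (τ.verts.erase a.1).image f.toFun = τ.verts.image f.toFun) :
          Set.InjOn f.toFun (τ.verts.erase a.1) :=
        Finset.card_image_iff.1 (by rw [h, hface a]; exact hc')
      rw [Fintype.sum_eq_add (⟨u, hu⟩ : τ.verts) ⟨v, hv⟩ (by simpa using huv) fun x hx => hzero x ?_]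
      · rw [cellMap_res f F (face τ ⟨u, hu⟩) (face_le τ _) ⟨f.onSimplices τ.simplex, hc'⟩
            (Simplices.ext hu') le_rfl,
          cellMap_res f F (face τ ⟨v, hv⟩) (face_le τ _) ⟨f.onSimplices τ.simplex, hc'⟩
            (Simplices.ext hv') le_rfl, smul_smul, smul_smul, ← add_smul]
        have h0 := posSign_mul_mapSign_add f hu hv huv hf (hinj ⟨u, hu⟩ hu') (hinj ⟨v, hv⟩ hv')
        exact (congrArg (· • _) h0).trans (zero_smul _ _)
      · intro h
        have hx1 : u ≠ x.1 := fun e => hx.1 (Subtype.ext e.symm)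
        have hx2 : v ≠ x.1 := fun e => hx.2 (Subtype.ext e.symm)
        have h1 : Set.InjOn f.toFun (τ.verts.erase x.1) :=
          Finset.card_image_iff.1 (Eq.trans h (hface x).symm)
        exact huv (h1 (Finset.mem_erase.2 ⟨hx1, hu⟩) (Finset.mem_erase.2 ⟨hx2, hv⟩) hf)
    -- If more vertices are lost, the image of every face has fewer than `k + 1` vertices.
    · refine Finset.sum_eq_zero fun v _ => hzero v fun h => ?_
      have h1 : (f.onSimplices (face τ v).simplex).verts.card ≤
          (f.onSimplices τ.simplex).verts.card :=
        Finset.card_le_card (f.monotone (face_le τ v))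
      omega

/-- The maps `f^k` commute with the coboundaries. -/
lemma cellMap_coboundary (k : ℕ) :
    cellMap f F k ≫ coboundary ((pullback M f).obj F) k =
      coboundary F k ≫ cellMap f F (k + 1) :=
  cochains_hom_ext fun τ => (coboundary_cellMap_proj f F τ).symm

/-- The morphism of cellular cochain complexes given by a simplicial map. -/
def cellHom : cellularComplex F ⟶ cellularComplex ((pullback M f).obj F) where
  f k := cellMap f F k
  comm' := by
    rintro k _ rfl
    rw [cellularComplex_d, cellularComplex_d]
    exact cellMap_coboundary f F k

variable {F} in
lemma cellMap_naturality {G : (space Y).Sheaf M} (φ : F ⟶ G) (k : ℕ) :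
    cochainsMap φ k ≫ cellMap f G k = cellMap f F k ≫ cochainsMap ((pullback M f).map φ) k := by
  refine cochains_hom_ext fun σ => ?_
  rw [Category.assoc, Category.assoc, cochainsMap_proj, ← Category.assoc (cellMap f F k)]
  by_cases h : (f.onSimplices σ.simplex).verts.card = k + 1
  · rw [cellMap_proj f G σ h, cellMap_proj f F σ h, Preadditive.comp_zsmul,
      Preadditive.zsmul_comp, Category.assoc, ← stalkMap_naturality, ← Category.assoc,
      cochainsMap_proj, Category.assoc]
  · rw [cellMap_proj_eq_zero f G σ h, cellMap_proj_eq_zero f F σ h, comp_zero, zero_comp]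

lemma augmentation_cellMap :
    augmentation F ≫ cellMap f F 0 =
      (globalSectionsMap M f).app F ≫ augmentation ((pullback M f).obj F) := by
  refine cochains_hom_ext fun σ => ?_
  obtain ⟨v, hv'⟩ := Finset.card_eq_one.1 σ.card_eq
  have hv : σ.verts = {v} := hv'
  have hc : (f.onSimplices σ.simplex).verts.card = 0 + 1 := by
    change (σ.verts.image f.toFun).card = 1
    rw [hv, Finset.image_singleton, Finset.card_singleton]
  have hs : mapSign f σ.verts = 1 := by
    rw [mapSign, hv, Finset.singleton_product_singleton, Finset.filter_singleton]
    simp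
  rw [Category.assoc, cellMap_proj f F σ hc, hs, one_smul, Category.assoc, augmentation_proj,
    ← Category.assoc, augmentation_proj]
  have h1 := ((TopCat.Sheaf.forget M (space Y)).map
    ((pullbackAdjunction M f).unit.app F)).naturality
    (homOfLE (le_top : star (f.onSimplices σ.simplex) ≤ ⊤)).op
  refine (Category.assoc _ _ _).symm.trans ((congrArg (· ≫ ((pullback M f).obj F).presheaf.map
    (homOfLE (show star σ.simplex ≤ (Opens.map f.onSpace).obj (star (f.onSimplices σ.simplex)) from
      fun _ h => f.monotone h)).op) h1).trans ?_)
  refine (Category.assoc _ _ _).trans (Eq.trans ?_ (Category.assoc _ _ _).symm)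
  refine congrArg (_ ≫ ·) ?_
  exact presheaf_map_comp_eq _
    (show (Opens.map f.onSpace).obj (star (f.onSimplices σ.simplex)) ≤
      (Opens.map f.onSpace).obj ⊤ from le_top) (fun _ h => f.monotone h)
    (show ⊤ ≤ (Opens.map f.onSpace).obj ⊤ from le_rfl) le_top

end CellMap

/-! ### Exact products and refinements. -/

section Products

variable {M : Type w} [Category.{u} M] [Abelian M] [IsGrothendieckAbelian.{u} M]

lemma epi_piMap [AB4Star M] {J : Type u} {A B : J → M} (p : ∀ j, A j ⟶ B j) [∀ j, Epi (p j)] :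
    Epi (Limits.Pi.map p) := by
  have : Epi (Discrete.natTrans (F := Discrete.functor A) (G := Discrete.functor B)
      fun j => p j.as) := by
    have (X : Discrete J) : Epi ((Discrete.natTrans (F := Discrete.functor A)
      (G := Discrete.functor B) fun j => p j.as).app X) := inferInstanceAs (Epi (p X.as))
    exact NatTrans.epi_of_epi_app _
  exact inferInstanceAs (Epi ((lim : (Discrete J ⥤ M) ⥤ M).map
    (Discrete.natTrans (F := Discrete.functor A) (G := Discrete.functor B) fun j => p j.as)))

/-- Families of epimorphisms to `A` have a common refinement. -/
lemma exists_common_refinement [AB4Star M] {J : Type u} {A : M} {B : J → M} (p : ∀ j, B j ⟶ A)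
    [∀ j, Epi (p j)] : ∃ (A' : M) (π : A' ⟶ A) (_ : Epi π) (t : ∀ j, A' ⟶ B j),
      ∀ j, t j ≫ p j = π := by
  have := epi_piMap p
  let d : A ⟶ ∏ᶜ fun _ : J => A := Pi.lift fun _ => 𝟙 A
  -- The refinement is the pullback of `∏ p_j` along the diagonal of `A`. It is an epimorphism
  -- because the product of the `p_j` is one.
  refine ⟨Limits.pullback d (Limits.Pi.map p), pullback.fst _ _, inferInstance,
    fun j => pullback.snd _ _ ≫ Pi.π _ j, fun j => ?_⟩
  rw [Category.assoc, ← Limits.Pi.map_π p j, ← Category.assoc, ← pullback.condition,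
    Category.assoc, Pi.lift_π, Category.comp_id]

end Products

/-! ### Exactness of cellular cochains in the sheaf. -/

section Rows

variable {M : Type w} [Category.{u} M] [Abelian M] [IsGrothendieckAbelian.{u} M]
variable {V : Type u} [LinearOrder V] {K : AbstractSimplicialComplex V}

lemma cochainsMap_mono {F G : (space K).Sheaf M} (φ : F ⟶ G) [Mono φ] (k : ℕ) :
    Mono (cochainsMap φ k) where
  right_cancellation a b hab := cochains_hom_ext fun σ => by
    rw [← cancel_mono ((sectionsAt M σ.simplex).map φ), Category.assoc, Category.assoc,
      ← cochainsMap_proj, ← Category.assoc, hab, Category.assoc]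

/-- Cellular cochains are an exact functor of the sheaf. -/
lemma cochainsMap_exact [AB4Star M] {S : ShortComplex ((space K).Sheaf M)} (hS : S.Exact) {k : ℕ}
    {A : M} (x : A ⟶ cochains S.X₂ k) (hx : x ≫ cochainsMap S.g k = 0) :
    ∃ (A' : M) (π : A' ⟶ A) (_ : Epi π) (y : A' ⟶ cochains S.X₁ k),
      π ≫ x = y ≫ cochainsMap S.f k := by
  have h (σ : KSimplex K k) : ∃ (B : M) (p : B ⟶ A) (_ : Epi p)
      (y : B ⟶ (sectionsAt M σ.simplex).obj S.X₁),
      p ≫ x ≫ proj _ σ = y ≫ (sectionsAt M σ.simplex).map S.f := by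
    refine (hS.map (sectionsAt M σ.simplex)).exact_up_to_refinements (x ≫ proj _ σ) ?_
    refine (Category.assoc _ _ _).trans ((congrArg (x ≫ ·) (cochainsMap_proj S.g σ)).symm.trans ?_)
    rw [← Category.assoc, hx]
    exact zero_comp
  choose B p hp y hy using h
  -- Each simplex has its own refinement; exactness of products supplies one that serves all of
  -- them.
  obtain ⟨A', π, hπ, t, ht⟩ := exists_common_refinement p
  refine ⟨A', π, hπ, liftCochains _ fun σ => t σ ≫ y σ, cochains_hom_ext fun σ => ?_⟩
  rw [Category.assoc, Category.assoc, cochainsMap_proj, ← Category.assoc (liftCochains _ _),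
    liftCochains_proj, Category.assoc, ← hy σ, ← Category.assoc (t σ), ht]

end Rows

/-! ### Cellular acyclicity of injective sheaves. -/

section Columns

variable {M : Type w} [Category.{u} M] [Abelian M] [IsGrothendieckAbelian.{u} M]
variable {V : Type u} {K : AbstractSimplicialComplex V}

/-- The sheaf `U ↦ ∏ F(ρ)`, the product over the simplices `ρ` in `U`. -/
def godement (F : (space K).Sheaf M) : (space K).Sheaf M :=
  coinduced id fun ρ => (sectionsAt M ρ).obj F

/-- The projection of the sections over `U_σ` to the component at a coface `ρ`. -/
def godementπ (F : (space K).Sheaf M) {σ ρ : Simplices K} (h : σ ≤ ρ) :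
    (sectionsAt M σ).obj (godement F) ⟶ (sectionsAt M ρ).obj F :=
  coinducedπ id (fun ρ => (sectionsAt M ρ).obj F) (U := star σ) ρ h

lemma res_godementπ (F : (space K).Sheaf M) {σ τ ρ : Simplices K} (h : σ ≤ τ) (h' : τ ≤ ρ) :
    res (godement F) h ≫ godementπ F h' = godementπ F (h.trans h') :=
  coinduced_map_π id (fun ρ => (sectionsAt M ρ).obj F) (star_le_star h) ρ h'

variable {F : (space K).Sheaf M}

lemma godement_hom_ext {A : M} {σ : Simplices K} {x y : A ⟶ (sectionsAt M σ).obj (godement F)}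
    (h : ∀ ρ (hρ : σ ≤ ρ), x ≫ godementπ F hρ = y ≫ godementπ F hρ) : x = y :=
  coinduced_hom_ext (j := id) (A := fun ρ => (sectionsAt M ρ).obj F) (U := star σ)
    fun ρ hρ => h ρ hρ

/-- Lifts to the sections over `U_σ` of the sheaf of products of the stalks. -/
def godementLift {A : M} (σ : Simplices K) (a : ∀ ρ, σ ≤ ρ → (A ⟶ (sectionsAt M ρ).obj F)) :
    A ⟶ (sectionsAt M σ).obj (godement F) :=
  coinducedLift id (fun ρ => (sectionsAt M ρ).obj F) (U := star σ) a

lemma godementLift_π {A : M} {σ : Simplices K}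
    (a : ∀ ρ, σ ≤ ρ → (A ⟶ (sectionsAt M ρ).obj F)) {ρ : Simplices K} (h : σ ≤ ρ) :
    godementLift σ a ≫ godementπ F h = a ρ h :=
  coinducedLift_π id (fun ρ => (sectionsAt M ρ).obj F) (U := star σ) a ρ h

variable (F) in
/-- The embedding of a sheaf in the sheaf of products of its stalks. -/
def toGodement : F ⟶ godement F := toCoinduced id fun _ => 𝟙 _

lemma toGodement_π {σ ρ : Simplices K} (h : σ ≤ ρ) :
    (sectionsAt M σ).map (toGodement F) ≫ godementπ F h = res F h :=
  (toCoinduced_app_π id (fun ρ => 𝟙 ((sectionsAt M ρ).obj F)) (U := star σ) ρ h).trans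
    (Category.comp_id _)

instance : Mono (toGodement F) := mono_of_mono_sectionsAt _ fun σ =>
  mono_of_mono_fac ((toGodement_π (le_refl σ)).trans (F.presheaf.map_id _) : _ = 𝟙 _)

variable [LinearOrder V]

variable (F) in
/-- The component in `F(ρ)` of a cochain at the simplex with the set `s` of vertices; zero, if `s`
is not a `k`-dimensional face of `ρ`. -/
def germ (ρ : Simplices K) (k : ℕ) (s : Finset V) : cochains F k ⟶ (sectionsAt M ρ).obj F :=
  if h : s.card = k + 1 ∧ s ⊆ ρ.verts then
    proj F ⟨⟨s, (K.isRelLowerSet_faces ρ.mem).2 h.2 (Finset.card_pos.1 (by omega))⟩, h.1⟩ ≫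
      res F h.2
  else 0

lemma germ_simplex {ρ : Simplices K} {k : ℕ} (σ : KSimplex K k) (h : σ.simplex ≤ ρ) :
    germ F ρ k σ.verts = proj F σ ≫ res F h :=
  dif_pos ⟨σ.card_eq, h⟩

lemma germ_eq_zero {ρ : Simplices K} {k : ℕ} {s : Finset V} (h : s.card ≠ k + 1) :
    germ F ρ k s = 0 :=
  dif_neg fun h' => h h'.1

lemma coboundary_germ {ρ : Simplices K} {k : ℕ} {s : Finset V} (hs : s.card = k + 1 + 1)
    (hρ : s ⊆ ρ.verts) :
    coboundary F k ≫ germ F ρ (k + 1) s =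
      ∑ v ∈ s, posSign s v • germ F ρ k (s.erase v) := by
  let τ : KSimplex K (k + 1) :=
    ⟨⟨s, (K.isRelLowerSet_faces ρ.mem).2 hρ (Finset.card_pos.1 (by omega))⟩, hs⟩
  have hτ : τ.simplex ≤ ρ := hρ
  have h1 : germ F ρ (k + 1) s = proj F τ ≫ res F hτ := germ_simplex τ hτ
  rw [h1, ← Category.assoc, coboundary_proj, Preadditive.sum_comp,
    ← Finset.sum_coe_sort s fun v => posSign s v • germ F ρ k (s.erase v)]
  refine Finset.sum_congr rfl fun v _ => ?_
  rw [Preadditive.zsmul_comp, Category.assoc, res_comp]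
  exact congrArg (posSign s v.1 • ·) (germ_simplex (face τ v) ((face_le τ v).trans hτ)).symm

/-- The least vertex of a simplex. -/
def leastVertex (ρ : Simplices K) : V := ρ.verts.min' (K.isRelLowerSet_faces ρ.mem).1

lemma leastVertex_mem (ρ : Simplices K) : leastVertex ρ ∈ ρ.verts := Finset.min'_mem _ _

lemma leastVertex_le (ρ : Simplices K) {x : V} (hx : x ∈ ρ.verts) : leastVertex ρ ≤ x :=
  Finset.min'_le _ _ hx

lemma posSign_leastVertex {ρ : Simplices K} {s : Finset V} (hs : s ⊆ ρ.verts) :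
    posSign s (leastVertex ρ) = 1 := by
  rw [posSign, Finset.filter_false_of_mem fun x hx => not_lt.2 (leastVertex_le ρ (hs hx)),
    Finset.card_empty, pow_zero]

lemma posSign_insert_leastVertex {ρ : Simplices K} {s : Finset V} (hs : s ⊆ ρ.verts)
    (hv : leastVertex ρ ∉ s) {x : V} (hx : x ∈ s) :
    posSign (insert (leastVertex ρ) s) x = -posSign s x := by
  have h : leastVertex ρ < x :=
    lt_of_le_of_ne (leastVertex_le ρ (hs hx)) fun e => hv (e ▸ hx)
  rw [posSign, posSign, Finset.filter_insert, if_pos h,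
    Finset.card_insert_of_notMem fun h' => hv (Finset.mem_filter.1 h').1, pow_succ]
  ring

/-- The contraction of the cochains of the simplex `ρ` to its least vertex. -/
lemma germ_contraction {ρ : Simplices K} {k : ℕ} (σ : KSimplex K k) (hσ : σ.simplex ≤ ρ) :
    coboundary F k ≫ germ F ρ (k + 1) (insert (leastVertex ρ) σ.verts) +
        ∑ x ∈ σ.verts, posSign σ.verts x •
          germ F ρ k (insert (leastVertex ρ) (σ.verts.erase x)) =
      germ F ρ k σ.verts := by
  have hσ' : σ.verts ⊆ ρ.verts := hσ
  by_cases hv : leastVertex ρ ∈ σ.verts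
  -- If the least vertex already lies in `σ`, inserting it gives a set too small for degree `k + 1`,
  -- and in the sum only the term that removes and restores it survives.
  · rw [germ_eq_zero (by rw [Finset.insert_eq_self.2 hv, σ.card_eq]; omega), comp_zero, zero_add,
      Finset.sum_eq_single_of_mem _ hv, posSign_leastVertex hσ', one_smul, Finset.insert_erase hv]
    intro x hx hxv
    have h : leastVertex ρ ∈ σ.verts.erase x := Finset.mem_erase.2 ⟨hxv.symm, hv⟩
    rw [germ_eq_zero, smul_zero]
    rw [Finset.insert_eq_self.2 h, Finset.card_erase_of_mem hx, σ.card_eq]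
    omega
  -- Otherwise the coboundary at the cone over `σ` consists of the germ at `σ`, with sign `1`, and
  -- of terms that cancel the sum: a new least vertex shifts all other positions by one.
  · have hs : insert (leastVertex ρ) σ.verts ⊆ ρ.verts :=
      Finset.insert_subset (leastVertex_mem ρ) hσ'
    rw [coboundary_germ (by rw [Finset.card_insert_of_notMem hv, σ.card_eq]) hs,
      Finset.sum_insert hv, posSign_leastVertex hs, one_smul, Finset.erase_insert hv, add_assoc,
      ← Finset.sum_add_distrib, Finset.sum_eq_zero, add_zero]
    intro x hx
    rw [posSign_insert_leastVertex hσ' hv hx,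
      Finset.erase_insert_of_ne (ne_of_mem_of_not_mem hx hv).symm,
      neg_smul, neg_add_cancel]

variable (F) in
/-- The contracting homotopy of the cellular cochain complex, with values in the larger sheaf. -/
def contraction (k : ℕ) : cochains F (k + 1) ⟶ cochains (godement F) k :=
  liftCochains _ fun σ => godementLift σ.simplex fun ρ _ =>
    germ F ρ (k + 1) (insert (leastVertex ρ) σ.verts)

lemma contraction_proj {k : ℕ} (σ : KSimplex K k) {ρ : Simplices K} (h : σ.simplex ≤ ρ) :
    contraction F k ≫ proj _ σ ≫ godementπ F h =
      germ F ρ (k + 1) (insert (leastVertex ρ) σ.verts) := by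
  rw [← Category.assoc, contraction, liftCochains_proj, godementLift_π]

variable (F) in
/-- The contracting homotopy of the augmented cellular cochain complex in degree `0`. -/
def contractionZero : cochains F 0 ⟶ (globalSections M K).obj (godement F) :=
  coinducedLift id (fun ρ => (sectionsAt M ρ).obj F) (U := ⊤) fun ρ _ => germ F ρ 0 {leastVertex ρ}

lemma contractionZero_resTop {σ ρ : Simplices K} (h : σ ≤ ρ) :
    contractionZero F ≫ resTop (godement F) σ ≫ godementπ F h =
      germ F ρ 0 {leastVertex ρ} := by
  have h1 : resTop (godement F) σ ≫ godementπ F h =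
      coinducedπ id (fun ρ => (sectionsAt M ρ).obj F) (U := ⊤) ρ trivial :=
    coinduced_map_π id (fun ρ => (sectionsAt M ρ).obj F) le_top ρ h
  rw [h1]
  exact coinducedLift_π id (fun ρ => (sectionsAt M ρ).obj F) (U := ⊤) _ ρ trivial

lemma cochainsMap_toGodement_proj {k : ℕ} (σ : KSimplex K k) {ρ : Simplices K}
    (h : σ.simplex ≤ ρ) :
    cochainsMap (toGodement F) k ≫ proj _ σ ≫ godementπ F h = germ F ρ k σ.verts := by
  rw [← Category.assoc, cochainsMap_proj, Category.assoc, toGodement_π, germ_simplex]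

-- The homotopy formula of the cone construction, checked on each germ by `germ_contraction`. It is
-- a homotopy from zero to the embedding `toGodement`, not to the identity.
variable (F) in
lemma contraction_succ (k : ℕ) :
    coboundary F (k + 1) ≫ contraction F (k + 1) + contraction F k ≫ coboundary (godement F) k =
      cochainsMap (toGodement F) (k + 1) := by
  refine cochains_hom_ext fun σ => godement_hom_ext fun ρ h => ?_
  rw [Category.assoc _ (proj _ σ), Category.assoc _ (proj _ σ), cochainsMap_toGodement_proj,
    Preadditive.add_comp, Category.assoc, contraction_proj, ← germ_contraction σ h, Category.assoc,
    ← Category.assoc (coboundary _ _), coboundary_proj, Preadditive.sum_comp,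
    Preadditive.comp_sum, ← Finset.sum_coe_sort σ.verts fun x =>
      posSign σ.verts x • germ F ρ (k + 1) (insert (leastVertex ρ) (σ.verts.erase x))]
  refine congrArg (_ + ·) (Finset.sum_congr rfl fun x _ => ?_)
  rw [Preadditive.zsmul_comp, Preadditive.comp_zsmul, Category.assoc, res_godementπ,
    contraction_proj]
  rfl

variable (F) in
lemma contraction_zero :
    coboundary F 0 ≫ contraction F 0 + contractionZero F ≫ augmentation (godement F) =
      cochainsMap (toGodement F) 0 := by
  refine cochains_hom_ext fun σ => godement_hom_ext fun ρ h => ?_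
  rw [Category.assoc _ (proj _ σ), Category.assoc _ (proj _ σ), cochainsMap_toGodement_proj,
    Preadditive.add_comp, Category.assoc, contraction_proj, ← germ_contraction σ h, Category.assoc,
    ← Category.assoc (augmentation _), augmentation_proj, contractionZero_resTop]
  refine congrArg (_ + ·) ?_
  obtain ⟨v, hv'⟩ := Finset.card_eq_one.1 σ.card_eq
  have hv : σ.verts = {v} := hv'
  rw [hv, Finset.sum_singleton]
  simp [posSign, Finset.filter_singleton]

lemma exists_retraction [Injective F] : ∃ r : godement F ⟶ F, toGodement F ≫ r = 𝟙 F :=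
  ⟨Injective.factorThru (𝟙 F) (toGodement F), Injective.comp_factorThru _ _⟩

/-- The cellular cochain complex of an injective sheaf is exact in positive degrees. -/
lemma coboundary_exact [Injective F] {k : ℕ} {A : M} (x : A ⟶ cochains F (k + 1))
    (hx : x ≫ coboundary F (k + 1) = 0) : ∃ y : A ⟶ cochains F k, x = y ≫ coboundary F k := by
  obtain ⟨r, hr⟩ := exists_retraction (F := F)
  refine ⟨x ≫ contraction F k ≫ cochainsMap r k, ?_⟩
  -- Composed with the retraction `r`, the right-hand side of the homotopy formula becomes the
  -- identity.
  have h := congrArg (x ≫ · ≫ cochainsMap r (k + 1)) (contraction_succ F k)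
  simp only [Preadditive.add_comp, Preadditive.comp_add, Category.assoc] at h
  rw [← Category.assoc x, hx, zero_comp, zero_add, ← cochainsMap_comp, hr, cochainsMap_id,
    Category.comp_id] at h
  refine h.symm.trans ?_
  rw [Category.assoc, Category.assoc, cochainsMap_coboundary]

/-- The degree `0` cocycles with values in an injective sheaf are the global sections. -/
lemma augmentation_exact [Injective F] {A : M} (x : A ⟶ cochains F 0)
    (hx : x ≫ coboundary F 0 = 0) :
    ∃ y : A ⟶ (globalSections M K).obj F, x = y ≫ augmentation F := by
  obtain ⟨r, hr⟩ := exists_retraction (F := F)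
  refine ⟨x ≫ contractionZero F ≫ (globalSections M K).map r, ?_⟩
  have h := congrArg (x ≫ · ≫ cochainsMap r 0) (contraction_zero F)
  simp only [Preadditive.add_comp, Preadditive.comp_add, Category.assoc] at h
  rw [← Category.assoc x, hx, zero_comp, zero_add, ← cochainsMap_comp, hr, cochainsMap_id,
    Category.comp_id] at h
  refine h.symm.trans ?_
  rw [Category.assoc, Category.assoc, augmentation_naturality]

-- The stars of the vertices cover the space: every simplex contains a vertex, here its least one.
variable (F) in
lemma augmentation_mono : Mono (augmentation F) where
  right_cancellation {A} a b hab := by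
    refine hom_sections_ext F (U := ⊤) fun σ _ => ?_
    have hv := leastVertex_mem σ
    let v : KSimplex K 0 := ⟨⟨{leastVertex σ}, (K.isRelLowerSet_faces σ.mem).2
      (Finset.singleton_subset_iff.2 hv) (Finset.singleton_nonempty _)⟩, Finset.card_singleton _⟩
    have hvσ : v.simplex ≤ σ := Finset.singleton_subset_iff.2 hv
    have h : augmentation F ≫ proj F v ≫ res F hvσ = resTop F σ := by
      rw [← Category.assoc, augmentation_proj, resTop_res]
    change a ≫ resTop F σ = b ≫ resTop F σ
    rw [← h, ← Category.assoc, hab, Category.assoc]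

end Columns

/-! ### The two quasi-isomorphisms to the total complex. -/

section Total

variable {M : Type w} [Category.{u} M] [Abelian M] [IsGrothendieckAbelian.{u} M]
variable {V : Type u} [LinearOrder V] {K : AbstractSimplicialComplex V}
variable {F : (space K).Sheaf M} (I : InjectiveResolution F)

/-- Morphisms from the total complex. -/
def totalDesc {n : ℕ} {A : M} (t : ∀ p q, p + q = n → (cochains (I.cocomplex.X p) q ⟶ A)) :
    (totalComplex I).X n ⟶ A :=
  (bicomplex I).totalDesc t

lemma ι_totalDesc {n : ℕ} {A : M} (t : ∀ p q, p + q = n → (cochains (I.cocomplex.X p) q ⟶ A))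
    (p q : ℕ) (h : p + q = n) : ι I p q n h ≫ totalDesc I t = t p q h :=
  (bicomplex I).ι_totalDesc (c₁₂ := ComplexShape.up ℕ) (f := t) p q h

variable {I} in
lemma total_hom_ext {n : ℕ} {A : M} {x y : (totalComplex I).X n ⟶ A}
    (h : ∀ p q hpq, ι I p q n hpq ≫ x = ι I p q n hpq ≫ y) : x = y :=
  HomologicalComplex₂.total.hom_ext (ComplexShape.up ℕ) h

/-- The projection of the total complex to `C^q(K, I^p)`. -/
def totalπ (p q n : ℕ) (h : p + q = n) :
    (totalComplex I).X n ⟶ cochains (I.cocomplex.X p) q :=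
  totalDesc I fun p' q' h' => if hp : p' = p then eqToHom (by
    obtain rfl := hp
    obtain rfl : q' = q := by omega
    rfl) else 0

lemma ι_totalπ (p q n : ℕ) (h : p + q = n) : ι I p q n h ≫ totalπ I p q n h = 𝟙 _ :=
  (ι_totalDesc I _ p q h).trans (dif_pos rfl)

lemma ι_totalπ_ne (p q p' q' n : ℕ) (h : p + q = n) (h' : p' + q' = n) (hp : p ≠ p') :
    ι I p q n h ≫ totalπ I p' q' n h' = 0 :=
  (ι_totalDesc I _ p q h).trans (dif_neg hp)

lemma sum_totalπ_ι (n : ℕ) :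
    ∑ p : Fin (n + 1), totalπ I p (n - p) n (by omega) ≫ ι I p (n - p) n (by omega) =
      𝟙 ((totalComplex I).X n) := by
  refine total_hom_ext fun p q hpq => ?_
  rw [Preadditive.comp_sum, Category.comp_id,
    Finset.sum_eq_single_of_mem (⟨p, by omega⟩ : Fin (n + 1)) (Finset.mem_univ _)]
  · obtain rfl : q = n - p := by omega
    rw [← Category.assoc, ι_totalπ, Category.id_comp]
  · intro p' _ hp'
    rw [← Category.assoc, ι_totalπ_ne _ _ _ _ _ _ _ _ fun e => hp' (Fin.ext e.symm), zero_comp]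

lemma totalπ_hom_ext {n : ℕ} {A : M} (x y : A ⟶ (totalComplex I).X n)
    (h : ∀ p q hpq, x ≫ totalπ I p q n hpq = y ≫ totalπ I p q n hpq) : x = y := by
  rw [← Category.comp_id x, ← Category.comp_id y, ← sum_totalπ_ι, Preadditive.comp_sum,
    Preadditive.comp_sum]
  refine Finset.sum_congr rfl fun p _ => ?_
  rw [← Category.assoc, h, Category.assoc]

/-- The total complex as the total complex of a first quadrant double complex. -/
def totalBigrading : Bigrading (totalComplex I) fun p q => cochains (I.cocomplex.X p) q where
  ι := ι I
  π := totalπ I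
  ι_π_self := ι_totalπ I
  ι_π_ne := ι_totalπ_ne I
  hom_ext := totalπ_hom_ext I
  a p q := cochainsMap (I.cocomplex.d p (p + 1)) q
  b p q := (-1 : ℤˣ) ^ p • coboundary (I.cocomplex.X p) q
  d_π_left n := total_hom_ext fun p q hpq => by
    rw [← Category.assoc, ← Category.assoc, ι_d, Preadditive.add_comp, Category.assoc,
      Linear.units_smul_comp, Category.assoc, ι_totalπ_ne I p (q + 1) _ _ _ _ _ (by omega),
      comp_zero, smul_zero, add_zero]
    obtain rfl | hp := eq_or_ne p n
    · obtain rfl : q = 0 := by omega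
      rw [ι_totalπ, ι_totalπ, Category.id_comp, Category.comp_id]
    · rw [ι_totalπ_ne _ _ _ _ _ _ _ _ (by omega), ι_totalπ_ne _ _ _ _ _ _ _ _ (by omega),
        comp_zero, zero_comp]
  d_π_right n := total_hom_ext fun p q hpq => by
    rw [← Category.assoc, ← Category.assoc, ι_d, Preadditive.add_comp, Category.assoc,
      ι_totalπ_ne I (p + 1) q _ _ _ _ _ (by omega), comp_zero, zero_add,
      Linear.units_smul_comp, Category.assoc]
    obtain rfl | hp := eq_or_ne p 0
    · obtain rfl : q = n := by omega
      rw [ι_totalπ, ι_totalπ, Category.id_comp, Category.comp_id]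
    · rw [ι_totalπ_ne _ _ _ _ _ _ _ _ (by omega), ι_totalπ_ne _ _ _ _ _ _ _ _ (by omega),
        comp_zero, zero_comp, smul_zero]
  d_π p q n h := total_hom_ext fun p' q' hpq => by
    rw [← Category.assoc, ι_d, Preadditive.comp_add, Preadditive.add_comp, Category.assoc,
      Linear.units_smul_comp, Category.assoc, ← Category.assoc (ι I p' q' n hpq),
      ← Category.assoc (ι I p' q' n hpq)]
    refine congrArg₂ (· + ·) ?_ ?_
    · obtain rfl | hp := eq_or_ne p' p
      · obtain rfl : q' = q + 1 := by omega
        rw [ι_totalπ, ι_totalπ, Category.id_comp, Category.comp_id]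
      · rw [ι_totalπ_ne _ _ _ _ _ _ _ _ (by omega), ι_totalπ_ne _ _ _ _ _ _ _ _ (by omega),
          comp_zero, zero_comp]
    · obtain rfl | hp := eq_or_ne p' (p + 1)
      · obtain rfl : q' = q := by omega
        rw [ι_totalπ, ι_totalπ, Category.id_comp, Category.comp_id]
      · rw [ι_totalπ_ne _ _ _ _ _ _ _ _ (by omega), ι_totalπ_ne _ _ _ _ _ _ _ _ (by omega),
          comp_zero, zero_comp, smul_zero]

/-- Since `C^q(K, -)` is exact, each row `C^q(K, I^•)` resolves `C^q(K, F)`. -/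
theorem isIso_cellularToTotal [AB4Star M] (k : ℕ) :
    IsIso (HomologicalComplex.homologyMap (cellularToTotal I) k) := by
  have h : (totalBigrading I).IsAugmentation (cellularToTotal I)
      fun q => cochainsMap (unitMap I) q :=
    { eq _ := rfl
      mono q := by
        have : Mono (unitMap I) := inferInstanceAs (Mono (I.ι.f 0))
        exact cochainsMap_mono _ q
      exact q A x hx := by
        have h0 : (ShortComplex.mk _ _ (unitMap_d I)).Exact := I.exact₀
        exact cochainsMap_exact h0 x hx }
  exact h.isIso_homologyMap (fun p q A x hx => cochainsMap_exact (I.exact_succ p) x hx) k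

/-- Now rows and columns are interchanged: `C^•(K, I^p)` resolves `Γ(K, I^p)`. The lifts come from
the contraction, so the identity serves as refinement. -/
theorem isIso_sectionsToTotal (k : ℕ) :
    IsIso (HomologicalComplex.homologyMap (sectionsToTotal I) k) := by
  have hs (p : ℕ) {A B : M} (x : A ⟶ B) (hx : (-1 : ℤˣ) ^ p • x = 0) : x = 0 :=
    (smul_eq_zero_iff_eq _).1 hx
  have h : (totalBigrading I).swap.IsAugmentation (sectionsToTotal I)
      fun q => augmentation (I.cocomplex.X q) :=
    { eq _ := rfl
      mono q := augmentation_mono _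
      exact q A x hx := by
        obtain ⟨y, hy⟩ := augmentation_exact x
          (hs q _ ((Linear.comp_units_smul _ _ _).symm.trans hx))
        exact ⟨A, 𝟙 A, inferInstance, y, (Category.id_comp _).trans hy⟩ }
  refine h.isIso_homologyMap (fun q p A x hx => ?_) k
  obtain ⟨y, hy⟩ := coboundary_exact x (hs p _ ((Linear.comp_units_smul _ _ _).symm.trans hx))
  -- The vertical differential carries the sign `(-1)^p`, which the preimage must compensate.
  refine ⟨A, 𝟙 A, inferInstance, (-1 : ℤˣ) ^ p • y, (Category.id_comp _).trans (hy.trans ?_)⟩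
  change _ = ((-1 : ℤˣ) ^ p • y) ≫ ((-1 : ℤˣ) ^ p • coboundary (I.cocomplex.X p) q)
  rw [Linear.units_smul_comp, Linear.comp_units_smul, smul_smul, ← mul_pow]
  simp

end Total

/-! ### Morphisms of total complexes. -/

section TotalMap

variable {M : Type w} [Category.{u} M] [Abelian M] [IsGrothendieckAbelian.{u} M]
variable {V W : Type u} [LinearOrder V] [LinearOrder W]
variable {K : AbstractSimplicialComplex V} {L : AbstractSimplicialComplex W}
variable {F : (space K).Sheaf M} {G : (space L).Sheaf M}
variable (I : InjectiveResolution F) (J : InjectiveResolution G)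

/-- The morphism of total complexes given by a morphism of double complexes. -/
def totalMap (t : ∀ p q, cochains (I.cocomplex.X p) q ⟶ cochains (J.cocomplex.X p) q)
    (ht : ∀ p q, cochainsMap (I.cocomplex.d p (p + 1)) q ≫ t (p + 1) q =
      t p q ≫ cochainsMap (J.cocomplex.d p (p + 1)) q)
    (ht' : ∀ p q, coboundary (I.cocomplex.X p) q ≫ t p (q + 1) =
      t p q ≫ coboundary (J.cocomplex.X p) q) : totalComplex I ⟶ totalComplex J where
  f n := totalDesc I fun p q h => t p q ≫ ι J p q n h
  comm' := by
    rintro n _ rfl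
    refine total_hom_ext fun p q hpq => ?_
    rw [← Category.assoc, ι_totalDesc, Category.assoc, ι_d, ← Category.assoc, ι_d,
      Preadditive.add_comp, Preadditive.comp_add, Category.assoc, ι_totalDesc,
      Linear.units_smul_comp, Linear.comp_units_smul, Category.assoc, ι_totalDesc,
      ← Category.assoc, ← Category.assoc, ← Category.assoc, ← Category.assoc, ht, ht']

lemma ι_totalMap (t : ∀ p q, cochains (I.cocomplex.X p) q ⟶ cochains (J.cocomplex.X p) q)
    (ht ht') (p q n : ℕ) (h : p + q = n) :
    ι I p q n h ≫ (totalMap I J t ht ht').f n = t p q ≫ ι J p q n h :=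
  ι_totalDesc I (fun p q h => t p q ≫ ι J p q n h) p q h

end TotalMap

/-! ### Canonical isomorphisms and independence of the resolution. -/

section Canonical

variable {M : Type w} [Category.{u} M] [Abelian M] [IsGrothendieckAbelian.{u} M]
variable {V : Type u} [LinearOrder V] {K : AbstractSimplicialComplex V}
variable {F : (space K).Sheaf M}

/-- The isomorphism of sheaf cohomology with the cohomology of the global sections of an injective
resolution. -/
def resolutionIso (I : InjectiveResolution F) (k : ℕ) :
    sheafCohomology F k ≅
      (((globalSections M K).mapHomologicalComplex (ComplexShape.up ℕ)).obj
        I.cocomplex).homology k :=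
  I.isoRightDerivedObj (globalSections M K) k

lemma IsCanonical.comp_eq {k : ℕ} {e : sheafCohomology F k ≅ (cellularComplex F).homology k}
    (he : IsCanonical F k e) (I : InjectiveResolution F) :
    e.hom ≫ HomologicalComplex.homologyMap (cellularToTotal I) k =
      (resolutionIso I k).hom ≫ HomologicalComplex.homologyMap (sectionsToTotal I) k :=
  (he I).2

/-- This carries the comparison from one resolution to another: both augmentations are natural in
the resolution. -/
lemma exists_totalMap_resolutions (I J : InjectiveResolution F) (φ : I.cocomplex ⟶ J.cocomplex)
    (hφ : unitMap I ≫ φ.f 0 = unitMap J) :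
    ∃ τ : totalComplex I ⟶ totalComplex J, cellularToTotal I ≫ τ = cellularToTotal J ∧
      sectionsToTotal I ≫ τ =
        ((globalSections M K).mapHomologicalComplex _).map φ ≫ sectionsToTotal J := by
  refine ⟨totalMap I J (fun p q => cochainsMap (φ.f p) q)
    (fun p q => by rw [← cochainsMap_comp, ← cochainsMap_comp, φ.comm])
    (fun p q => (cochainsMap_coboundary _ _).symm), ?_, ?_⟩
  · ext n
    refine (Category.assoc _ _ _).trans
      ((congrArg (cochainsMap (unitMap I) n ≫ ·) (ι_totalMap I J _ _ _ 0 n n _)).trans ?_)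
    rw [← Category.assoc, ← cochainsMap_comp, hφ]
    rfl
  · ext n
    refine (Category.assoc _ _ _).trans
      ((congrArg (augmentation _ ≫ ·) (ι_totalMap I J _ _ _ n 0 n _)).trans ?_)
    rw [← Category.assoc, ← augmentation_naturality]
    exact Category.assoc _ _ _

/-- There is a canonical isomorphism between sheaf cohomology and cellular cohomology. -/
theorem exists_isCanonical [AB4Star M] (F : (space K).Sheaf M) (k : ℕ) :
    ∃ e : sheafCohomology F k ≅ (cellularComplex F).homology k, IsCanonical F k e := by
  let I := injectiveResolution F
  have := isIso_cellularToTotal I k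
  have := isIso_sectionsToTotal I k
  refine ⟨resolutionIso I k ≪≫
    asIso (HomologicalComplex.homologyMap (sectionsToTotal I) k) ≪≫
    (asIso (HomologicalComplex.homologyMap (cellularToTotal I) k)).symm,
    fun J => ⟨isIso_cellularToTotal J k, ?_⟩⟩
  -- The isomorphism is built from the one resolution `I`. A lift `φ` of the identity of `F` carries
  -- its defining equation over to an arbitrary `J`.
  let φ : I.cocomplex ⟶ J.cocomplex := InjectiveResolution.desc (𝟙 F) J I
  have hφ : I.ι.f 0 ≫ φ.f 0 = 𝟙 F ≫ J.ι.f 0 := InjectiveResolution.desc_commutes_zero _ _ _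
  obtain ⟨τ, h1, h2⟩ := exists_totalMap_resolutions I J φ (hφ.trans (Category.id_comp _))
  have h3 := InjectiveResolution.isoRightDerivedObj_hom_naturality (𝟙 F) I J φ hφ
    (globalSections M K) k
  rw [CategoryTheory.Functor.map_id, Category.id_comp] at h3
  have h4 : (resolutionIso J k).hom = (resolutionIso I k).hom ≫ HomologicalComplex.homologyMap
      (((globalSections M K).mapHomologicalComplex _).map φ) k := h3
  change _ = (resolutionIso J k).hom ≫ _
  have h5 := congrArg (HomologicalComplex.homologyMap · k) h2
  simp only [HomologicalComplex.homologyMap_comp] at h5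
  rw [h4, ← h1, HomologicalComplex.homologyMap_comp, Category.assoc, ← h5]
  simp

end Canonical

/-! ### Comparison of the sheaf and cellular maps. -/

section Functoriality

variable {M : Type w} [Category.{u} M] [Abelian M] [IsGrothendieckAbelian.{u} M]
variable {V W : Type u} [LinearOrder V] [LinearOrder W]
variable {X : AbstractSimplicialComplex V} {Y : AbstractSimplicialComplex W}
variable {f : SimplicialMap X Y} {F : (space Y).Sheaf M}

/-- The components of the lift of the identity of `f^*F`. -/
def InducedMapData.component (D : InducedMapData f F) (p : ℕ) :
    (pullback M f).obj (D.I.cocomplex.X p) ⟶ D.J.cocomplex.X p :=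
  D.g.f p

lemma InducedMapData.component_d (D : InducedMapData f F) (p : ℕ) :
    (pullback M f).map (D.I.cocomplex.d p (p + 1)) ≫ D.component (p + 1) =
      D.component p ≫ D.J.cocomplex.d p (p + 1) :=
  (D.g.comm p (p + 1)).symm

lemma InducedMapData.unitMap_component (D : InducedMapData f F) :
    (pullback M f).map (unitMap D.I) ≫ D.component 0 = unitMap D.J :=
  D.comm

/-- On `C^q(Y, I^p)` the morphism is `f^q` followed by the map of cochains given by `g` in degree
`p`. Naturality of `f^q` in the sheaf gives compatibility with the resolution differentials, and
`augmentation_cellMap` that with global sections. -/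
lemma exists_totalMap_cellMap (D : InducedMapData f F) :
    ∃ τ : totalComplex D.I ⟶ totalComplex D.J,
      cellularToTotal D.I ≫ τ = cellHom f F ≫ cellularToTotal D.J ∧
      sectionsToTotal D.I ≫ τ =
        ((NatTrans.mapHomologicalComplex (globalSectionsMap M f) _).app D.I.cocomplex ≫
          ((globalSections M X).mapHomologicalComplex _).map D.g) ≫ sectionsToTotal D.J := by
  refine ⟨totalMap D.I D.J
    (fun p q => cellMap f (D.I.cocomplex.X p) q ≫ cochainsMap (D.component p) q)
    (fun p q => ?_) (fun p q => ?_), ?_, ?_⟩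
  · rw [← Category.assoc, cellMap_naturality, Category.assoc, Category.assoc, ← cochainsMap_comp,
      ← cochainsMap_comp, D.component_d]
  · rw [← Category.assoc, ← cellMap_coboundary, Category.assoc, Category.assoc,
      cochainsMap_coboundary]
  · ext n
    refine (Category.assoc _ _ _).trans ((congrArg (cochainsMap (unitMap D.I) n ≫ ·)
      (ι_totalMap D.I D.J _ _ _ 0 n n _)).trans ?_)
    rw [← Category.assoc, ← Category.assoc, cellMap_naturality, Category.assoc (cellMap _ _ _),
      ← cochainsMap_comp, D.unitMap_component]
    exact Category.assoc _ _ _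
  · ext n
    refine (Category.assoc _ _ _).trans ((congrArg (augmentation _ ≫ ·)
      (ι_totalMap D.I D.J _ _ _ n 0 n _)).trans ?_)
    rw [← Category.assoc, ← Category.assoc, augmentation_cellMap, Category.assoc _ (augmentation _),
      ← augmentation_naturality, ← Category.assoc, Category.assoc]
    rfl

lemma InducedMapData.inducedMap_eq (D : InducedMapData f F) (k : ℕ) :
    D.inducedMap k = (resolutionIso D.I k).hom ≫
      HomologicalComplex.homologyMap
        ((NatTrans.mapHomologicalComplex (globalSectionsMap M f) _).app D.I.cocomplex ≫
          ((globalSections M X).mapHomologicalComplex _).map D.g) k ≫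
      (resolutionIso D.J k).inv :=
  rfl

/-- Under canonical isomorphisms, the map of sheaf cohomology is the map of cellular cohomology. -/
theorem inducedMap_comp_canonical (D : InducedMapData f F) {k : ℕ}
    {eY : sheafCohomology F k ≅ (cellularComplex F).homology k}
    {eX : sheafCohomology ((pullback M f).obj F) k ≅
      (cellularComplex ((pullback M f).obj F)).homology k}
    (hY : IsCanonical F k eY) (hX : IsCanonical ((pullback M f).obj F) k eX) :
    D.inducedMap k ≫ eX.hom = eY.hom ≫ HomologicalComplex.homologyMap (cellHom f F) k := by
  obtain ⟨τ, h1, h2⟩ := exists_totalMap_cellMap D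
  have := (hX D.J).1
  -- As `cellularToTotal D.J` is an isomorphism on cohomology, the equation may be checked in the
  -- total complex of `D.J`, where both sides factor through `τ`.
  rw [← cancel_mono (HomologicalComplex.homologyMap (cellularToTotal D.J) k), Category.assoc,
    hX.comp_eq, Category.assoc, ← HomologicalComplex.homologyMap_comp, ← h1,
    HomologicalComplex.homologyMap_comp, ← Category.assoc eY.hom, hY.comp_eq, Category.assoc,
    ← HomologicalComplex.homologyMap_comp, h2, D.inducedMap_eq, Category.assoc,
    Category.assoc, Iso.inv_hom_id_assoc, HomologicalComplex.homologyMap_comp]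

end Functoriality

end CellSheaf

end

theorem theorem546 {M : Type w} [Category.{u} M] [Abelian M] [IsGrothendieckAbelian.{u} M]
    [AB4Star M] {V W : Type u} [LinearOrder V] [LinearOrder W]
    {X : AbstractSimplicialComplex V} {Y : AbstractSimplicialComplex W}
    (f : CellSheaf.SimplicialMap X Y) (F : (CellSheaf.space Y).Sheaf M) :
    (∀ σ : CellSheaf.Simplices X, IsIso (CellSheaf.stalkMap f F σ)) ∧
    Nonempty (CellSheaf.InducedMapData f F) ∧
    ∃ φ : CellSheaf.cellularComplex F ⟶
        CellSheaf.cellularComplex ((CellSheaf.pullback M f).obj F),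
      (∀ k, φ.f k = CellSheaf.cellMap f F k) ∧
      ∃ (eY : ∀ k, CellSheaf.sheafCohomology F k ≅ (CellSheaf.cellularComplex F).homology k)
        (eX : ∀ k, CellSheaf.sheafCohomology ((CellSheaf.pullback M f).obj F) k ≅
          (CellSheaf.cellularComplex ((CellSheaf.pullback M f).obj F)).homology k),
        (∀ k, CellSheaf.IsCanonical F k (eY k)) ∧
        (∀ k, CellSheaf.IsCanonical ((CellSheaf.pullback M f).obj F) k (eX k)) ∧
        ∀ (D : CellSheaf.InducedMapData f F) (k : ℕ),
          D.inducedMap k ≫ (eX k).hom =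
            (eY k).hom ≫ HomologicalComplex.homologyMap φ k := by
  choose eY hY using CellSheaf.exists_isCanonical F
  choose eX hX using CellSheaf.exists_isCanonical ((CellSheaf.pullback M f).obj F)
  exact ⟨CellSheaf.isIso_stalkMap f F, CellSheaf.nonempty_inducedMapData f F,
    CellSheaf.cellHom f F, fun _ => rfl, eY, eX, hY, hX,
    fun D k => CellSheaf.inducedMap_comp_canonical D (hY k) (hX k)⟩
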